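/- Let $\mathcal H_2$ be the Siegel half space of symmetric $\tau=\begin{pmatrix}z_1&z_3\\z_3&z_2\end{pmatrix}\in M_2(\mathbb C)$ with $\operatorname{Im}\tau$ positive definite, and write $z_j=x_j+iy_j$. For $a,b\in\{0,1\}^2$ let $$\theta_{a,b}(\tau)=\sum_{m\in\mathbb Z^2}\exp\Bigl(i\pi\Bigl(\bigl(m+\tfrac a2\bigr)^t\tau\bigl(m+\tfrac a2\bigr)+2\bigl(m+\tfrac a2\bigr)^t\tfrac b2\Bigr)\Bigr),$$ and write $\theta_j=\theta_{(a_0,a_1),(b_0,b_1)}$ where $j=b_0+2b_1+4a_0+8a_1\in\{0,\dots,15\}$. The group $\mathrm{Sp}_4(\mathbb Z)$ acts on $\mathcal H_2$ by $\begin{pmatrix}A&B\\C&D\end{pmatrix}\tau=(A\tau+B)(C\tau+D)^{-1}$. Put $\gamma_0=I_4$ and, for $k=1,2,3$, $$\gamma_k=\begin{pmatrix}-I_2&-S_k\\S_k&-I_2+S_k^2\end{pmatrix}\in\mathrm{Sp}_4(\mathbb Z),\qquad S_1=\begin{pmatrix}1&0\\0&0\end{pmatrix},\ S_2=\begin{pmatrix}0&0\\0&1\end{pmatrix},\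 S_3=\begin{pmatrix}0&1\\1&0\end{pmatrix}.$$ Let $\mathcal F'$ be the set of all $\tau\in\mathcal H_2$ such that $|x_j|\le\frac12$ for $j=1,2,3$, $2|y_3|\le y_1\le y_2$, $y_1\ge\frac{\sqrt3}2$, and $|z_1|\ge1$, $|z_2|\ge1$. Let $\mathcal F_2$ be the usual fundamental domain for $\mathrm{Sp}_4(\mathbb Z)$, i.e. the set of all $\tau\in\mathcal H_2$ such that $|x_j|\le\frac12$ for $j=1,2,3$, $0\le2y_3\le y_1\le y_2$, and $|\det(C\tau+D)|\ge1$ for all $\begin{pmatrix}A&B\\C&D\end{pmatrix}\in\mathrm{Sp}_4(\mathbb Z)$. A set of complex numbers is in *good position* if it is contained in an open quarter plane, i.e. in the image of $\{z:\operatorname{Re}z>0,\ \operatorname{Im}z>0\}$ under a rotation about $0$. A sequence $(s_b^{(n)})_{b\in(\mathbb Z/2\mathbb Z)^2,\,n\ge0}$ of complex numbers is a *Borchardt sequence given by good sign choices* if for every $n\ge0$ there are square roots $t_b^{(n)}$ of $s_b^{(n)}$, $b\in(\mathbb Z/2\mathbb Z)^2$, which are in good position and satisfy $s_b^{(n+1)}=\frac14\sum_{b_1+b_2=b}t_{b_1}^{(n)}t_{b_2}^{(n)}$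 for every $b$. **Theorem.** We have $\mathcal F_2\subset\mathcal F'$. Let $\tau\in\mathcal F'$ and $0\le k\le3$. Then for every $n\ge0$ the theta constants $\theta_j(2^n\gamma_k\tau)$, $0\le j\le3$, are contained in a common open quarter plane. Consequently, $B(\gamma_k\tau)=\bigl(\theta_{0,b}^2(2^n\gamma_k\tau)\bigr)_{b\in\{0,1\}^2,\,n\ge0}$ is a Borchardt sequence given by good sign choices. -/

import Mathlib

open Matrix

noncomputable section

/-- The Siegel half space of genus `2`. -/
def SiegelH2 : Set (Matrix (Fin 2) (Fin 2) ℂ) :=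
  {τ | τ.IsSymm ∧ (τ.map Complex.im).PosDef}

/-- The theta constant `θ_{a,b}` of genus `2`, with characteristics `a, b ∈ {0,1}²`
(encoded as elements of `(ℤ/2ℤ)²`, represented by `0` and `1`). -/
def theta (a b : Fin 2 → ZMod 2) (τ : Matrix (Fin 2) (Fin 2) ℂ) : ℂ :=
  ∑' m : Fin 2 → ℤ,
    let v : Fin 2 → ℂ := fun i => (m i : ℂ) + ((a i).val : ℂ) / 2
    let w : Fin 2 → ℂ := fun i => ((b i).val : ℂ) / 2
    Complex.exp (Complex.I * Real.pi * (v ⬝ᵥ (τ *ᵥ v) + 2 * (v ⬝ᵥ w)))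

/-- The numbering `θ_j = θ_{(a₀,a₁),(b₀,b₁)}` for `j = b₀ + 2 b₁ + 4 a₀ + 8 a₁` in `{0,…,15}`;
the casts to `ZMod 2` extract the binary digits of `j`. -/
def thetaNum (j : ℕ) (τ : Matrix (Fin 2) (Fin 2) ℂ) : ℂ :=
  theta ![((j / 4 : ℕ) : ZMod 2), ((j / 8 : ℕ) : ZMod 2)]
    ![(j : ZMod 2), ((j / 2 : ℕ) : ZMod 2)] τ

/-- The integer blocks `A, B, C, D` of a symplectic matrix, as complex matrices. -/
def blockA (γ : symplecticGroup (Fin 2) ℤ) : Matrix (Fin 2) (Fin 2) ℂ :=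
  γ.1.toBlocks₁₁.map (fun x : ℤ => (x : ℂ))

def blockB (γ : symplecticGroup (Fin 2) ℤ) : Matrix (Fin 2) (Fin 2) ℂ :=
  γ.1.toBlocks₁₂.map (fun x : ℤ => (x : ℂ))

def blockC (γ : symplecticGroup (Fin 2) ℤ) : Matrix (Fin 2) (Fin 2) ℂ :=
  γ.1.toBlocks₂₁.map (fun x : ℤ => (x : ℂ))

def blockD (γ : symplecticGroup (Fin 2) ℤ) : Matrix (Fin 2) (Fin 2) ℂ :=
  γ.1.toBlocks₂₂.map (fun x : ℤ => (x : ℂ))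

/-- The action `γτ = (Aτ + B)(Cτ + D)⁻¹` of `Sp₄(ℤ)` on the Siegel half space. -/
def spAct (γ : symplecticGroup (Fin 2) ℤ) (τ : Matrix (Fin 2) (Fin 2) ℂ) :
    Matrix (Fin 2) (Fin 2) ℂ :=
  (blockA γ * τ + blockB γ) * (blockC γ * τ + blockD γ)⁻¹

/-- For symmetric `S`, the symplectic matrix with blocks `-1, -S, S, -1 + S²`. -/
def gammaOf (S : Matrix (Fin 2) (Fin 2) ℤ) (hS : Sᵀ = S) : symplecticGroup (Fin 2) ℤ :=
  ⟨fromBlocks (-1) (-S) S (-1 + S ^ 2), by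
    rw [SymplecticGroup.mem_iff]
    simp only [J, fromBlocks_transpose, fromBlocks_multiply, transpose_neg, transpose_add,
      transpose_one, transpose_pow, hS]
    congr 1 <;> noncomm_ring⟩

/-- The matrices `γ₀, γ₁, γ₂, γ₃` in `Sp₄(ℤ)`. -/
def gamma : Fin 4 → symplecticGroup (Fin 2) ℤ :=
  ![1,
    gammaOf !![1, 0; 0, 0] (by decide),
    gammaOf !![0, 0; 0, 1] (by decide),
    gammaOf !![0, 1; 1, 0] (by decide)]

/-- The domain `F'`. Here `τ 0 0 = z₁`, `τ 1 1 = z₂`, `τ 0 1 = z₃`. -/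
def FPrime : Set (Matrix (Fin 2) (Fin 2) ℂ) :=
  {τ | τ ∈ SiegelH2 ∧
    |(τ 0 0).re| ≤ 1 / 2 ∧ |(τ 1 1).re| ≤ 1 / 2 ∧ |(τ 0 1).re| ≤ 1 / 2 ∧
    2 * |(τ 0 1).im| ≤ (τ 0 0).im ∧ (τ 0 0).im ≤ (τ 1 1).im ∧
    Real.sqrt 3 / 2 ≤ (τ 0 0).im ∧
    1 ≤ ‖τ 0 0‖ ∧ 1 ≤ ‖τ 1 1‖}

/-- The usual fundamental domain for the action of `Sp₄(ℤ)` on the Siegel half space: real part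
bounded by `1/2`, imaginary part Minkowski-reduced, and `|det(Cτ + D)| ≥ 1` throughout
`Sp₄(ℤ)`. -/
def FTwo : Set (Matrix (Fin 2) (Fin 2) ℂ) :=
  {τ | τ ∈ SiegelH2 ∧
    |(τ 0 0).re| ≤ 1 / 2 ∧ |(τ 1 1).re| ≤ 1 / 2 ∧ |(τ 0 1).re| ≤ 1 / 2 ∧
    0 ≤ 2 * (τ 0 1).im ∧ 2 * (τ 0 1).im ≤ (τ 0 0).im ∧ (τ 0 0).im ≤ (τ 1 1).im ∧
    ∀ γ : symplecticGroup (Fin 2) ℤ, 1 ≤ ‖(blockC γ * τ + blockD γ).det‖}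

/-- A set of complex numbers is in good position if it lies in an open quarter plane, that is, in
the image of the open first quadrant under a rotation about the origin. -/
def InGoodPosition (s : Set ℂ) : Prop :=
  ∃ u : ℂ, u ≠ 0 ∧ ∀ z ∈ s, 0 < (u * z).re ∧ 0 < (u * z).im

/-- `s` is a Borchardt sequence, with `t` as the choice of square roots. -/
def IsBorchardtWith (s t : ℕ → (Fin 2 → ZMod 2) → ℂ) : Prop :=
  ∀ n, (∀ b, t n b ^ 2 = s n b) ∧
    ∀ b, s (n + 1) b =
      1 / 4 * ∑ p : (Fin 2 → ZMod 2) × (Fin 2 → ZMod 2) with p.1 + p.2 = b, t n p.1 * t n p.2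

/-- `s` is a Borchardt sequence given by good sign choices. -/
def IsGoodBorchardt (s : ℕ → (Fin 2 → ZMod 2) → ℂ) : Prop :=
  ∃ t, IsBorchardtWith s t ∧ ∀ n, InGoodPosition (Set.range (t n))

/-- The sequence `B(τ)` of the squares `θ_{0,b}(2ⁿτ)²`. -/
def borchardtSeq (τ : Matrix (Fin 2) (Fin 2) ℂ) : ℕ → (Fin 2 → ZMod 2) → ℂ :=
  fun n b => theta 0 b ((2 : ℂ) ^ n • τ) ^ 2

end

/-
For `n = 0` the assertion is explicit: up to a common factor, the transformation law of theta series
turns the `θ_{0,b}(γ_k τ)` into theta constants `θ_{a,b}(τ)`, whose expansions are dominated by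
their leading terms. The conditions on `τ` then make any two of these numbers enclose an acute
angle, and finitely many complex numbers enclosing pairwise acute angles lie in an open quarter
plane.

For the induction, let `σ = 2ⁿ γ_k τ` and suppose that the `θ_{0,b}(σ)` are in good position. After
a rotation their pairwise products lie in the open upper half plane, so by the duplication formula
the `θ_{0,b}(2σ)²` lie in a common open half plane, and no two of the `θ_{0,b}(2σ)` are orthogonal.
As `τ` varies over a connected domain, the angle between two of them therefore cannot pass from
acute to obtuse, and at `τ = 2i` it is acute because all `θ_{0,b}(2σ)` are close to `1`.
-/

namespace SiegelTheta

open Complex ComplexConjugate Topology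

section Series

variable {ι : Type*}

/-- The lattice point `m` shifted by half of the integral characteristic `a`. -/
def halfShift (K : Type*) [DivisionRing K] (a m : ι → ℤ) : ι → K :=
  fun i => m i + a i / 2

lemma halfShift_zero (K : Type*) [DivisionRing K] (m : ι → ℤ) :
    halfShift K 0 m = fun i => (m i : K) := by
  ext i
  simp [halfShift]

/-- The representative in `{0, 1}` of a characteristic modulo `2`. -/
def zmodLift (b : ι → ZMod 2) : ι → ℤ := fun i => (b i).val

lemma zmodLift_zero : zmodLift (0 : ι → ZMod 2) = 0 := rfl

variable [Fintype ι]

/-- The `m`-th summand of the theta constant of genus `|ι|` with characteristics `a` and `b`, which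
are allowed to be arbitrary integral vectors. -/
noncomputable def thetaTerm (a b : ι → ℤ) (τ : Matrix ι ι ℂ) (m : ι → ℤ) : ℂ :=
  cexp (Real.pi * I * (halfShift ℂ a m ⬝ᵥ τ *ᵥ halfShift ℂ a m +
    halfShift ℂ a m ⬝ᵥ fun i => (b i : ℂ)))

/-- The theta constant of genus `|ι|` with integral characteristics `a` and `b`. -/
noncomputable def thetaSeries (a b : ι → ℤ) (τ : Matrix ι ι ℂ) : ℂ :=
  ∑' m : ι → ℤ, thetaTerm a b τ m

lemma norm_cexp_pi_mul_I_mul (z : ℂ) : ‖cexp (Real.pi * I * z)‖ = Real.exp (-Real.pi * z.im) := by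
  simp [Complex.norm_exp, mul_assoc]

lemma norm_thetaTerm (a b : ι → ℤ) (τ : Matrix ι ι ℂ) (m : ι → ℤ) :
    ‖thetaTerm a b τ m‖ =
      Real.exp (-Real.pi * (halfShift ℝ a m ⬝ᵥ τ.map im *ᵥ halfShift ℝ a m)) := by
  have hv : halfShift ℂ a m = fun i => (halfShift ℝ a m i : ℂ) := by
    ext i
    simp [halfShift]
  rw [thetaTerm, norm_cexp_pi_mul_I_mul, hv]
  simp [dotProduct, mulVec]

section PiProduct

variable {κ : Type*} {f : ι → κ → ℝ}

lemma sum_prod_apply_le_prod_tsum (hf : ∀ i k, 0 ≤ f i k) (hs : ∀ i, Summable (f i))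
    (u : Finset (ι → κ)) : ∑ m ∈ u, ∏ i, f i (m i) ≤ ∏ i, ∑' k, f i k := by
  classical
  calc ∑ m ∈ u, ∏ i, f i (m i)
      ≤ ∑ m ∈ Fintype.piFinset fun i => u.image (· i), ∏ i, f i (m i) := by
        refine Finset.sum_le_sum_of_subset_of_nonneg (fun m hm => ?_)
          fun m _ _ => Finset.prod_nonneg fun i _ => hf i _
        exact Fintype.mem_piFinset.2 fun i => Finset.mem_image_of_mem (· i) hm
    _ = ∏ i, ∑ k ∈ u.image (· i), f i k := (Finset.prod_univ_sum _ _).symm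
    _ ≤ ∏ i, ∑' k, f i k := Finset.prod_le_prod
        (fun i _ => Finset.sum_nonneg fun k _ => hf i k)
        fun i _ => (hs i).sum_le_tsum _ fun k _ => hf i k

lemma summable_prod_apply (hf : ∀ i k, 0 ≤ f i k) (hs : ∀ i, Summable (f i)) :
    Summable fun m : ι → κ => ∏ i, f i (m i) :=
  summable_of_sum_le (fun _ => Finset.prod_nonneg fun i _ => hf i _)
    (sum_prod_apply_le_prod_tsum hf hs)

end PiProduct

lemma summable_exp_neg_sq_add_half (a : ℤ) {ε : ℝ} (hε : 0 < ε) :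
    Summable fun n : ℤ => Real.exp (-Real.pi * (ε * ((n : ℝ) + a / 2) ^ 2)) := by
  refine .of_nonneg_of_le (fun _ => Real.exp_nonneg _) (fun n => ?_)
    (summable_pow_mul_jacobiTheta₂_term_bound (ε * |(a : ℝ)| / 2) hε 0)
  rw [pow_zero, one_mul, Real.exp_le_exp, neg_mul, neg_mul, neg_le_neg_iff]
  have hcross : -(|(a : ℝ)| * |(n : ℝ)|) ≤ a * n := by
    rw [← abs_mul]
    exact neg_abs_le _
  gcongr
  push_cast
  nlinarith [mul_le_mul_of_nonneg_left hcross hε.le, mul_nonneg hε.le (sq_nonneg (a : ℝ))]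

lemma summable_exp_neg_halfShift (a : ι → ℤ) {ε : ℝ} (hε : 0 < ε) :
    Summable fun m : ι → ℤ =>
      Real.exp (-Real.pi * (ε * (halfShift ℝ a m ⬝ᵥ halfShift ℝ a m))) := by
  have hprod := summable_prod_apply (fun _ _ => Real.exp_nonneg _)
    fun i => summable_exp_neg_sq_add_half (a i) hε
  simpa only [← Real.exp_sum, ← Finset.mul_sum, pow_two, dotProduct, halfShift] using hprod

lemma isCompact_setOf_dotProduct_self_eq_one : IsCompact {v : ι → ℝ | v ⬝ᵥ v = 1} := by
  have hclosed : IsClosed {v : ι → ℝ | v ⬝ᵥ v = 1} :=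
    isClosed_eq (by unfold dotProduct; fun_prop) continuous_const
  refine (isCompact_univ_pi fun _ : ι => isCompact_Icc (a := (-1 : ℝ)) (b := 1)).of_isClosed_subset
    hclosed fun v (hv : v ⬝ᵥ v = 1) i _ => abs_le.1 ?_
  rw [← sq_le_one_iff_abs_le_one, ← hv, pow_two]
  exact Finset.single_le_sum (f := fun j => v j * v j) (fun j _ => mul_self_nonneg _)
    (Finset.mem_univ i)

lemma exists_pos_eventually_mul_dotProduct_le {A : Matrix ι ι ℝ} (hA : A.PosDef) :
    ∃ ε > 0, ∀ᶠ B in 𝓝 A, ∀ v : ι → ℝ, ε * (v ⬝ᵥ v) ≤ v ⬝ᵥ B *ᵥ v := by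
  have hcont : Continuous fun p : Matrix ι ι ℝ × (ι → ℝ) => p.2 ⬝ᵥ p.1 *ᵥ p.2 := by fun_prop
  have hK := isCompact_setOf_dotProduct_self_eq_one (ι := ι)
  obtain ⟨c, hc, hcA⟩ := hK.exists_forall_le' (a := 0)
    (hcont.comp (Continuous.prodMk_right A)).continuousOn fun v (hv : v ⬝ᵥ v = 1) => by
      have hv0 : v ≠ 0 := by
        rintro rfl
        simp at hv
      simpa using hA.dotProduct_mulVec_pos hv0
  have hB : ∀ᶠ B in 𝓝 A, ∀ v ∈ {v : ι → ℝ | v ⬝ᵥ v = 1}, c / 2 < v ⬝ᵥ B *ᵥ v :=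
    hK.eventually_forall_of_forall_eventually fun v hv =>
      hcont.continuousAt.eventually_const_lt ((half_lt_self hc).trans_le (hcA v hv))
  refine ⟨c / 2, half_pos hc, hB.mono fun B hB v => ?_⟩
  have hnonneg : 0 ≤ v ⬝ᵥ v := Finset.sum_nonneg fun i _ => mul_self_nonneg (v i)
  obtain hv | hv := hnonneg.eq_or_lt
  · rw [eq_comm, dotProduct_self_eq_zero] at hv
    simp [hv]
  · have hs : √(v ⬝ᵥ v) * √(v ⬝ᵥ v) = v ⬝ᵥ v := Real.mul_self_sqrt hv.le
    have hunit := hB ((√(v ⬝ᵥ v))⁻¹ • v) (by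
      simp only [Set.mem_ofPred_eq, smul_dotProduct, dotProduct_smul, smul_eq_mul]
      rw [← mul_assoc, ← mul_inv, hs, inv_mul_cancel₀ hv.ne'])
    simp only [mulVec_smul, smul_dotProduct, dotProduct_smul, smul_eq_mul] at hunit
    rw [← mul_assoc, ← mul_inv, hs, inv_mul_eq_div, lt_div_iff₀ hv] at hunit
    exact hunit.le

lemma norm_thetaTerm_le {τ : Matrix ι ι ℂ} {ε : ℝ}
    (h : ∀ v : ι → ℝ, ε * (v ⬝ᵥ v) ≤ v ⬝ᵥ τ.map im *ᵥ v) (a b m : ι → ℤ) :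
    ‖thetaTerm a b τ m‖ ≤
      Real.exp (-Real.pi * (ε * (halfShift ℝ a m ⬝ᵥ halfShift ℝ a m))) := by
  rw [norm_thetaTerm, Real.exp_le_exp, neg_mul, neg_mul, neg_le_neg_iff]
  gcongr
  exact h _

lemma summable_norm_thetaTerm {τ : Matrix ι ι ℂ} (h : (τ.map im).PosDef) (a b : ι → ℤ) :
    Summable fun m => ‖thetaTerm a b τ m‖ := by
  obtain ⟨ε, hε, hτ⟩ := exists_pos_eventually_mul_dotProduct_le h
  exact .of_nonneg_of_le (fun _ => norm_nonneg _) (norm_thetaTerm_le hτ.self_of_nhds a b)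
    (summable_exp_neg_halfShift a hε)

lemma continuousAt_thetaSeries (a b : ι → ℤ) {τ : Matrix ι ι ℂ} (h : (τ.map im).PosDef) :
    ContinuousAt (thetaSeries a b) τ := by
  obtain ⟨ε, hε, hτ⟩ := exists_pos_eventually_mul_dotProduct_le h
  have him : Continuous fun σ : Matrix ι ι ℂ => σ.map im :=
    continuous_id.matrix_map Complex.continuous_im
  refine ContinuousOn.continuousAt (continuousOn_tsum (fun m => ?_)
    (summable_exp_neg_halfShift a hε) fun m σ hσ => norm_thetaTerm_le hσ a b m)
    (him.continuousAt.eventually hτ)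
  unfold thetaTerm
  fun_prop

lemma cexp_pi_mul_I_mul_congr {x y : ℂ} (k : ℤ) (h : x = y + 2 * k) :
    cexp (Real.pi * I * x) = cexp (Real.pi * I * y) := by
  rw [h, Complex.exp_eq_exp_iff_exists_int]
  exact ⟨k, by ring⟩

lemma cexp_pi_mul_I_mul_intCast (k : ℤ) : cexp (Real.pi * I * k) = (-1) ^ k := by
  rw [mul_comm, Complex.exp_int_mul, Complex.exp_pi_mul_I]

lemma intCast_dotProduct (R : Type*) [Ring R] (v w : ι → ℤ) :
    ((v ⬝ᵥ w : ℤ) : R) = (fun i => (v i : R)) ⬝ᵥ fun i => (w i : R) :=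
  RingHom.map_dotProduct (Int.castRingHom R) v w

lemma intCast_mulVec (R : Type*) [Ring R] (S : Matrix ι ι ℤ) (v : ι → ℤ) :
    (fun i => ((S *ᵥ v) i : R)) = S.map (↑) *ᵥ fun i => (v i : R) :=
  funext fun i => RingHom.map_mulVec (Int.castRingHom R) S v i

lemma thetaTerm_zero (b : ι → ℤ) (τ : Matrix ι ι ℂ) (m : ι → ℤ) :
    thetaTerm 0 b τ m = (-1) ^ (m ⬝ᵥ b) * thetaTerm 0 0 τ m := by
  rw [← cexp_pi_mul_I_mul_intCast, thetaTerm, thetaTerm, ← Complex.exp_add, intCast_dotProduct,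
    halfShift_zero]
  congr 1
  rw [show (fun i => (((0 : ι → ℤ) i : ℤ) : ℂ)) = 0 by ext; simp, dotProduct_zero]
  ring

lemma thetaSeries_mulVec {U : Matrix ι ι ℤ} [DecidableEq ι] (hU : IsUnit U) (a b : ι → ℤ)
    (τ : Matrix ι ι ℂ) :
    thetaSeries (U *ᵥ a) b τ =
      thetaSeries a (Uᵀ *ᵥ b) ((U.map (↑))ᵀ * τ * U.map (↑)) := by
  have hbij : Function.Bijective (U *ᵥ ·) :=
    ⟨mulVec_injective_of_isUnit hU, mulVec_surjective_iff_isUnit.2 hU⟩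
  rw [thetaSeries, ← (Equiv.ofBijective _ hbij).tsum_eq]
  refine tsum_congr fun m => ?_
  have hv : halfShift ℂ (U *ᵥ a) (U *ᵥ m) = U.map (↑) *ᵥ halfShift ℂ a m := by
    ext i
    simp only [halfShift, mulVec, dotProduct, map_apply, mul_add, Finset.sum_add_distrib,
      Finset.sum_div, Int.cast_sum, Int.cast_mul, mul_div_assoc]
  simp only [thetaTerm, Equiv.ofBijective_apply, hv, intCast_mulVec]
  simp only [← mulVec_mulVec, dotProduct_mulVec, vecMul_transpose, transpose_map]

lemma thetaSeries_add_two_mul (a b k l : ι → ℤ) (τ : Matrix ι ι ℂ) :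
    thetaSeries (a + 2 * k) (b + 2 * l) τ = (-1) ^ (a ⬝ᵥ l) * thetaSeries a b τ := by
  rw [thetaSeries, thetaSeries, ← (Equiv.subRight k).tsum_eq, ← tsum_mul_left]
  refine tsum_congr fun m => ?_
  have hv : halfShift ℂ (a + 2 * k) (m - k) = halfShift ℂ a m := by
    ext i
    simp [halfShift]
    ring
  rw [← cexp_pi_mul_I_mul_intCast, thetaTerm, thetaTerm, ← Complex.exp_add, Equiv.subRight_apply,
    hv, ← mul_add]
  refine cexp_pi_mul_I_mul_congr (m ⬝ᵥ l) ?_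
  have hl : (halfShift ℂ a m ⬝ᵥ fun i => (((b + 2 * l) i : ℤ) : ℂ)) =
      (halfShift ℂ a m ⬝ᵥ fun i => (b i : ℂ)) + (((a ⬝ᵥ l : ℤ) : ℂ) + 2 * (m ⬝ᵥ l : ℤ)) := by
    rw [intCast_dotProduct, intCast_dotProduct]
    simp only [dotProduct, halfShift, Finset.mul_sum, ← Finset.sum_add_distrib]
    refine Finset.sum_congr rfl fun i _ => ?_
    simp
    ring
  rw [hl]
  ring

lemma dotProduct_mulVec_self_of_charTwo {R : Type*} [CommRing R] [CharP R 2]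
    {S : Matrix ι ι R} (hS : S.IsSymm) (v : ι → R) :
    v ⬝ᵥ S *ᵥ v = ∑ i, S i i * v i ^ 2 := by
  classical
  have hoff : ∑ p ∈ Finset.univ.offDiag, v p.1 * (S p.1 p.2 * v p.2) = 0 := by
    refine Finset.sum_involution (fun p _ => p.swap) (fun p _ => ?_) ?_ ?_ ?_
    · rw [Prod.fst_swap, Prod.snd_swap, hS.apply, mul_left_comm (v p.2), mul_comm (v p.2),
        ← mul_left_comm, CharTwo.add_self_eq_zero]
    · intro p hp _ h
      exact (Finset.mem_offDiag.1 hp).2.2 (congrArg Prod.snd h)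
    · simp [ne_comm]
    · simp
  simp only [dotProduct, mulVec, Finset.mul_sum]
  rw [← Finset.sum_product', ← Finset.diag_union_offDiag,
    Finset.sum_union (Finset.disjoint_diag_offDiag _), hoff, add_zero, Finset.sum_diag]
  exact Finset.sum_congr rfl fun i _ => by ring

lemma thetaSeries_zero_sub_intCast {S : Matrix ι ι ℤ} (hS : S.IsSymm) {b c : ι → ℤ}
    (h : ∀ i, b i ≡ c i + S i i [ZMOD 2]) (τ : Matrix ι ι ℂ) :
    thetaSeries 0 b (τ - S.map (↑)) = thetaSeries 0 c τ := by
  refine tsum_congr fun m => ?_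
  obtain ⟨k, hk⟩ : (2 : ℤ) ∣ m ⬝ᵥ b - m ⬝ᵥ S *ᵥ m - m ⬝ᵥ c := by
    have hS' : (S.map ((↑) : ℤ → ZMod 2)).IsSymm := hS.map _
    rw [← Nat.cast_two, ← CharP.intCast_eq_zero_iff (ZMod 2) 2]
    push_cast [intCast_dotProduct, intCast_mulVec]
    rw [dotProduct_mulVec_self_of_charTwo hS']
    simp only [dotProduct, map_apply, ← Finset.sum_sub_distrib]
    refine Finset.sum_eq_zero fun i _ => ?_
    have hi := (ZMod.intCast_eq_intCast_iff _ _ _).2 (h i)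
    push_cast at hi
    rw [hi, ZMod.pow_card]
    ring
  refine cexp_pi_mul_I_mul_congr k ?_
  have hk' := congrArg (Int.cast : ℤ → ℂ) hk
  push_cast [intCast_dotProduct, intCast_mulVec] at hk'
  rw [halfShift_zero, sub_mulVec, dotProduct_sub]
  linear_combination hk'

lemma neg_one_zpow_congr {j k : ℤ} (h : (j : ZMod 2) = k) : (-1 : ℂ) ^ j = (-1) ^ k := by
  have heven : Even (j - k) := by
    rw [even_iff_two_dvd]
    exact (ZMod.intCast_eq_intCast_iff_dvd_sub _ _ 2).1 h.symm
  rw [← sub_add_cancel j k, zpow_add₀ (by norm_num), heven.neg_one_zpow, one_mul]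

lemma neg_one_zpow_dotProduct_zmodLift_add (m : ι → ℤ) (b c : ι → ZMod 2) :
    (-1 : ℂ) ^ (m ⬝ᵥ zmodLift (b + c)) =
      (-1) ^ (m ⬝ᵥ zmodLift b) * (-1) ^ (m ⬝ᵥ zmodLift c) := by
  rw [← zpow_add₀ (by norm_num), ← dotProduct_add]
  refine neg_one_zpow_congr ?_
  simp [zmodLift, dotProduct]

lemma sum_neg_one_zpow_dotProduct_zmodLift [DecidableEq ι] (m : ι → ℤ) :
    ∑ c : ι → ZMod 2, (-1 : ℂ) ^ (m ⬝ᵥ zmodLift c) =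
      if ∀ i, Even (m i) then 2 ^ Fintype.card ι else 0 := by
  have hprod (c : ι → ZMod 2) : (-1 : ℂ) ^ (m ⬝ᵥ zmodLift c) = ∏ i, (-1) ^ (m i * (c i).val) := by
    simp only [dotProduct, zmodLift, ← cexp_pi_mul_I_mul_intCast, ← Complex.exp_sum,
      ← Finset.mul_sum, ← Int.cast_sum]
  have hsum (k : ℤ) : ∑ x : ZMod 2, (-1 : ℂ) ^ (k * x.val) = if Even k then 2 else 0 := by
    have h01 : ∑ x : ZMod 2, (-1 : ℂ) ^ (k * x.val) = (-1) ^ (k * 0) + (-1) ^ (k * 1) :=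
      Fin.sum_univ_two fun x : ZMod 2 => (-1 : ℂ) ^ (k * x.val)
    rw [h01, mul_zero, mul_one, zpow_zero]
    split_ifs with hk
    · rw [hk.neg_one_zpow]
      norm_num
    · rw [(Int.not_even_iff_odd.1 hk).neg_one_zpow]
      norm_num
  simp only [hprod]
  rw [← Fintype.piFinset_univ, ← Finset.prod_univ_sum (fun _ => Finset.univ)
    fun i (x : ZMod 2) => (-1 : ℂ) ^ (m i * x.val)]
  simp only [hsum, Finset.prod_ite_zero, Finset.prod_const, Finset.mem_univ, forall_const,
    Finset.card_univ]

lemma tsum_ite_even_add (f : (ι → ℤ) × (ι → ℤ) → ℂ) :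
    ∑' z, (if ∀ i, Even (z.1 i + z.2 i) then f z else 0) =
      ∑' z : (ι → ℤ) × (ι → ℤ), f (z.1 + z.2, z.1 - z.2) := by
  have hinj : Function.Injective fun z : (ι → ℤ) × (ι → ℤ) => (z.1 + z.2, z.1 - z.2) := by
    rintro ⟨k, l⟩ ⟨k', l'⟩ h
    simp only [Prod.mk.injEq, funext_iff, Pi.add_apply, Pi.sub_apply] at h ⊢
    constructor <;> intro i <;> linarith [h.1 i, h.2 i]
  rw [← hinj.tsum_eq]
  · refine tsum_congr fun z => if_pos fun i => ⟨z.1 i, ?_⟩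
    simp only [Pi.add_apply, Pi.sub_apply]
    ring
  · rintro ⟨m, n⟩ hmn
    obtain ⟨heven, -⟩ := ite_ne_right_iff.1 hmn
    choose k hk using heven
    refine ⟨(k, m - k), ?_⟩
    simp only [Prod.mk.injEq, funext_iff, Pi.add_apply, Pi.sub_apply] at hk ⊢
    constructor <;> intro i <;> linarith [hk i]

lemma thetaTerm_zero_add_mul_thetaTerm_zero_sub (b : ι → ℤ) (τ : Matrix ι ι ℂ) (k l : ι → ℤ) :
    thetaTerm 0 0 τ (k + l) * thetaTerm 0 b τ (k - l) =
      thetaTerm 0 b ((2 : ℂ) • τ) k * thetaTerm 0 b ((2 : ℂ) • τ) l := by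
  simp only [thetaTerm, ← Complex.exp_add, ← mul_add]
  refine cexp_pi_mul_I_mul_congr (-(l ⬝ᵥ b)) ?_
  have hadd : halfShift ℂ 0 (k + l) = halfShift ℂ 0 k + halfShift ℂ 0 l := by
    ext i
    simp [halfShift]
  have hsub : halfShift ℂ 0 (k - l) = halfShift ℂ 0 k - halfShift ℂ 0 l := by
    ext i
    simp [halfShift]
  push_cast [intCast_dotProduct]
  rw [hadd, hsub, ← halfShift_zero ℂ l]
  simp only [mulVec_add, mulVec_sub, dotProduct_add, dotProduct_sub, add_dotProduct,
    sub_dotProduct, smul_mulVec, dotProduct_smul, smul_eq_mul]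
  rw [show (fun i => (((0 : ι → ℤ) i : ℤ) : ℂ)) = 0 by ext; simp]
  simp only [dotProduct_zero]
  ring

theorem sum_thetaSeries_mul_thetaSeries [DecidableEq ι] {τ : Matrix ι ι ℂ} (h : (τ.map im).PosDef)
    (b : ι → ZMod 2) :
    ∑ c, thetaSeries 0 (zmodLift c) τ * thetaSeries 0 (zmodLift (b + c)) τ =
      2 ^ Fintype.card ι * thetaSeries 0 (zmodLift b) ((2 : ℂ) • τ) ^ 2 := by
  have h2 : (((2 : ℂ) • τ).map im).PosDef := by
    convert h.smul (two_pos (α := ℝ)) using 1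
    ext i j
    simp
  have hterm (c : ι → ZMod 2) (z : (ι → ℤ) × (ι → ℤ)) :
      thetaTerm 0 (zmodLift c) τ z.1 * thetaTerm 0 (zmodLift (b + c)) τ z.2 =
        (-1) ^ ((z.1 + z.2) ⬝ᵥ zmodLift c) *
          (thetaTerm 0 0 τ z.1 * thetaTerm 0 (zmodLift b) τ z.2) := by
    rw [thetaTerm_zero (zmodLift c), thetaTerm_zero (zmodLift (b + c)), thetaTerm_zero (zmodLift b),
      neg_one_zpow_dotProduct_zmodLift_add, add_dotProduct, zpow_add₀ (by norm_num)]
    ring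
  have hs (c : ι → ZMod 2) := summable_norm_thetaTerm h 0 (zmodLift c)
  calc ∑ c, thetaSeries 0 (zmodLift c) τ * thetaSeries 0 (zmodLift (b + c)) τ
      = ∑ c, ∑' z : (ι → ℤ) × (ι → ℤ),
          thetaTerm 0 (zmodLift c) τ z.1 * thetaTerm 0 (zmodLift (b + c)) τ z.2 :=
        Finset.sum_congr rfl fun c _ => tsum_mul_tsum_of_summable_norm (hs c) (hs (b + c))
    _ = ∑' z : (ι → ℤ) × (ι → ℤ), ∑ c,
          thetaTerm 0 (zmodLift c) τ z.1 * thetaTerm 0 (zmodLift (b + c)) τ z.2 :=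
        (Summable.tsum_finsetSum fun c _ => summable_mul_of_summable_norm (hs c) (hs (b + c))).symm
    _ = ∑' z : (ι → ℤ) × (ι → ℤ), 2 ^ Fintype.card ι * if ∀ i, Even (z.1 i + z.2 i) then
          thetaTerm 0 0 τ z.1 * thetaTerm 0 (zmodLift b) τ z.2 else 0 := tsum_congr fun z => by
        simp only [hterm, ← Finset.sum_mul, sum_neg_one_zpow_dotProduct_zmodLift, Pi.add_apply]
        split_ifs <;> simp
    _ = 2 ^ Fintype.card ι * thetaSeries 0 (zmodLift b) ((2 : ℂ) • τ) ^ 2 := by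
        have hQ := summable_norm_thetaTerm h2 0 (zmodLift b)
        rw [tsum_mul_left, tsum_ite_even_add, pow_two, thetaSeries,
          tsum_mul_tsum_of_summable_norm hQ hQ]
        simp only [thetaTerm_zero_add_mul_thetaTerm_zero_sub]

end Series

lemma posDef_fin_two_iff {A : Matrix (Fin 2) (Fin 2) ℝ} :
    A.PosDef ↔ A.IsSymm ∧ 0 < A 0 0 ∧ A 0 1 ^ 2 < A 0 0 * A 1 1 := by
  constructor
  · intro h
    have hsymm : A.IsSymm := h.isHermitian
    have hdet := h.det_pos
    rw [det_fin_two, hsymm.apply 0 1] at hdet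
    exact ⟨hsymm, h.diag_pos, by linarith⟩
  · rintro ⟨hsymm, h₀, hdet⟩
    refine .of_dotProduct_mulVec_pos hsymm fun v hv => ?_
    have hexp : A 0 0 * (star v ⬝ᵥ A *ᵥ v) =
        (A 0 0 * v 0 + A 0 1 * v 1) ^ 2 + (A 0 0 * A 1 1 - A 0 1 ^ 2) * v 1 ^ 2 := by
      simp [mulVec, dotProduct, Fin.sum_univ_two, hsymm.apply 0 1]
      ring
    refine pos_of_mul_pos_right (hexp ▸ ?_) h₀.le
    obtain h1 | h1 := eq_or_ne (v 1) 0
    · have h0 : v 0 ≠ 0 := fun h0 => hv (funext (Fin.forall_fin_two.2 ⟨h0, h1⟩))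
      rw [h1, mul_zero, add_zero, zero_pow two_ne_zero, mul_zero, add_zero]
      exact sq_pos_of_ne_zero (mul_ne_zero h₀.ne' h0)
    · have := mul_pos (sub_pos.2 hdet) (sq_pos_of_ne_zero h1)
      positivity

lemma mem_siegelH2_iff {τ : Matrix (Fin 2) (Fin 2) ℂ} :
    τ ∈ SiegelH2 ↔ τ.IsSymm ∧ 0 < (τ 0 0).im ∧ (τ 0 1).im ^ 2 < (τ 0 0).im * (τ 1 1).im := by
  rw [SiegelH2, Set.mem_ofPred_eq, posDef_fin_two_iff]
  simp only [map_apply]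
  exact ⟨fun h => ⟨h.1, h.2.2⟩, fun h => ⟨h.1, h.1.map _, h.2⟩⟩

lemma isSymm_fin_two_iff {α : Type*} {A : Matrix (Fin 2) (Fin 2) α} :
    A.IsSymm ↔ A 1 0 = A 0 1 := by
  refine ⟨fun h => h.apply 0 1, fun h => IsSymm.ext ?_⟩
  simp [Fin.forall_fin_two, h]

lemma zero_eq_vec : (0 : Fin 2 → ℤ) = ![0, 0] := by decide

section Transformations

variable {τ : Matrix (Fin 2) (Fin 2) ℂ}

lemma im_one_one_pos (h : τ ∈ SiegelH2) : 0 < (τ 1 1).im := by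
  rw [mem_siegelH2_iff] at h
  exact pos_of_mul_pos_right ((sq_nonneg _).trans_lt h.2.2) h.2.1.le

/-- The action of the permutation of the two variables on `SiegelH2`. -/
def swapVars (τ : Matrix (Fin 2) (Fin 2) ℂ) : Matrix (Fin 2) (Fin 2) ℂ :=
  !![τ 1 1, τ 1 0; τ 0 1, τ 0 0]

/-- The action of the change of sign of the second variable on `SiegelH2`. -/
def flipSign (τ : Matrix (Fin 2) (Fin 2) ℂ) : Matrix (Fin 2) (Fin 2) ℂ :=
  !![τ 0 0, -τ 0 1; -τ 1 0, τ 1 1]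

/-- The action on `SiegelH2` of the inversion `z ↦ -1 / z` in the first variable. -/
noncomputable def partialInv (τ : Matrix (Fin 2) (Fin 2) ℂ) : Matrix (Fin 2) (Fin 2) ℂ :=
  !![-1 / τ 0 0, -τ 0 1 / τ 0 0; -τ 1 0 / τ 0 0, τ 1 1 - τ 0 1 ^ 2 / τ 0 0]

lemma ne_zero_of_mem_siegelH2 (h : τ ∈ SiegelH2) : τ 0 0 ≠ 0 := by
  intro h0
  simpa [h0] using (mem_siegelH2_iff.1 h).2.1

lemma swapVars_mem_siegelH2 (h : τ ∈ SiegelH2) : swapVars τ ∈ SiegelH2 := by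
  have h1 := im_one_one_pos h
  rw [mem_siegelH2_iff, isSymm_fin_two_iff] at h ⊢
  simp only [swapVars, of_apply, cons_val', cons_val_zero, cons_val_one, cons_val_fin_one]
  exact ⟨h.1.symm, h1, by rw [h.1, mul_comm]; exact h.2.2⟩

lemma flipSign_mem_siegelH2 (h : τ ∈ SiegelH2) : flipSign τ ∈ SiegelH2 := by
  rw [mem_siegelH2_iff, isSymm_fin_two_iff] at h ⊢
  simpa [flipSign] using h

lemma partialInv_mem_siegelH2 (h : τ ∈ SiegelH2) : partialInv τ ∈ SiegelH2 := by
  have hN : 0 < normSq (τ 0 0) := normSq_pos.2 (ne_zero_of_mem_siegelH2 h)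
  obtain ⟨hsymm, him, hdet⟩ := mem_siegelH2_iff.1 h
  have him' : (-1 / τ 0 0).im = (τ 0 0).im / normSq (τ 0 0) := by
    rw [neg_div, Complex.neg_im, one_div, Complex.inv_im]
    ring
  have hdet' : (-1 / τ 0 0).im * (τ 1 1 - τ 0 1 ^ 2 / τ 0 0).im - (-τ 0 1 / τ 0 0).im ^ 2 =
      ((τ 0 0).im * (τ 1 1).im - (τ 0 1).im ^ 2) / normSq (τ 0 0) := by
    have hN' : (τ 0 0).re ^ 2 + (τ 0 0).im ^ 2 ≠ 0 := by
      rw [normSq_apply] at hN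
      nlinarith
    rw [him']
    simp only [Complex.sub_im, Complex.div_im, Complex.neg_re, Complex.neg_im, pow_two,
      Complex.mul_re, Complex.mul_im, normSq_apply]
    simp only [← pow_two]
    field_simp
    ring
  rw [mem_siegelH2_iff, isSymm_fin_two_iff]
  simp only [partialInv, of_apply, cons_val', cons_val_zero, cons_val_one, cons_val_fin_one]
  refine ⟨by rw [hsymm.apply 0 1], him' ▸ div_pos him hN, ?_⟩
  rw [← sub_pos, hdet']
  exact div_pos (sub_pos.2 hdet) hN

lemma sub_intCast_mem_siegelH2 (h : τ ∈ SiegelH2) {S : Matrix (Fin 2) (Fin 2) ℤ} (hS : S.IsSymm) :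
    τ - S.map (↑) ∈ SiegelH2 := by
  rw [mem_siegelH2_iff] at h ⊢
  simpa using ⟨h.1.sub (hS.map _), h.2⟩

lemma smul_mem_siegelH2 (h : τ ∈ SiegelH2) {r : ℝ} (hr : 0 < r) : (r : ℂ) • τ ∈ SiegelH2 := by
  refine ⟨h.1.smul _, ?_⟩
  convert h.2.smul hr using 1
  ext i j
  simp

lemma theta_eq_thetaSeries (a b : Fin 2 → ZMod 2) (τ : Matrix (Fin 2) (Fin 2) ℂ) :
    theta a b τ = thetaSeries (zmodLift a) (zmodLift b) τ := by
  refine tsum_congr fun m => ?_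
  simp only [thetaTerm, halfShift, zmodLift, dotProduct, Finset.mul_sum, Int.cast_natCast]
  rw [mul_comm I]
  congr 3
  exact Finset.sum_congr rfl fun i _ => by ring

lemma theta_zero_sq_two_smul (h : τ ∈ SiegelH2) (b : Fin 2 → ZMod 2) :
    theta 0 b ((2 : ℂ) • τ) ^ 2 =
      1 / 4 * ∑ p : (Fin 2 → ZMod 2) × (Fin 2 → ZMod 2) with p.1 + p.2 = b,
        theta 0 p.1 τ * theta 0 p.2 τ := by
  have hcancel (c d : Fin 2 → ZMod 2) : c + (c + d) = d := by
    rw [← add_assoc, CharTwo.add_self_eq_zero, zero_add]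
  have hsum : ∑ p : (Fin 2 → ZMod 2) × (Fin 2 → ZMod 2) with p.1 + p.2 = b,
      theta 0 p.1 τ * theta 0 p.2 τ = ∑ c : Fin 2 → ZMod 2, theta 0 c τ * theta 0 (b + c) τ := by
    refine Finset.sum_bij' (fun p _ => p.1) (fun c _ => (c, b + c)) ?_ ?_ ?_ ?_ ?_
    · simp
    · simp [add_comm b, hcancel]
    · rintro ⟨c, d⟩ hp
      rw [Finset.mem_filter] at hp
      simp [← hp.2, add_comm (c + d), hcancel]
    · simp
    · rintro ⟨c, d⟩ hp
      rw [Finset.mem_filter] at hp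
      simp [← hp.2, add_comm (c + d), hcancel]
  rw [hsum]
  simp only [theta_eq_thetaSeries, zmodLift_zero]
  rw [sum_thetaSeries_mul_thetaSeries h.2, Fintype.card_fin]
  ring

lemma thetaSeries_swapVars (a b : Fin 2 → ℤ) (τ : Matrix (Fin 2) (Fin 2) ℂ) :
    thetaSeries a b (swapVars τ) = thetaSeries ![a 1, a 0] ![b 1, b 0] τ := by
  have hU : IsUnit !![(0 : ℤ), 1; 1, 0] := by
    rw [isUnit_iff_isUnit_det, det_fin_two_of]
    norm_num
  convert (thetaSeries_mulVec hU a ![b 1, b 0] τ).symm using 2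
  · ext i
    fin_cases i <;> simp [mulVec, dotProduct, Fin.sum_univ_two]
  · ext i j
    fin_cases i <;> fin_cases j <;> simp [swapVars, mul_apply, Fin.sum_univ_two]
  · ext i
    fin_cases i <;> simp [mulVec, dotProduct, Fin.sum_univ_two]

lemma thetaSeries_flipSign {a b : Fin 2 → ℤ} (h : a 1 * b 1 = 0)
    (τ : Matrix (Fin 2) (Fin 2) ℂ) : thetaSeries a b (flipSign τ) = thetaSeries a b τ := by
  have hU : IsUnit !![(1 : ℤ), 0; 0, -1] := by
    rw [isUnit_iff_isUnit_det, det_fin_two_of]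
    norm_num
  have hflip := thetaSeries_mulVec hU a (b + 2 * ![0, -b 1]) τ
  have ha : !![(1 : ℤ), 0; 0, -1] *ᵥ a = a + 2 * ![0, -a 1] := by
    ext i
    fin_cases i <;> simp [mulVec, dotProduct, Fin.sum_univ_two]
    ring
  have hsign : a ⬝ᵥ ![0, -b 1] = 0 := by simp [dotProduct, Fin.sum_univ_two, h]
  rw [ha, thetaSeries_add_two_mul, hsign, zpow_zero, one_mul] at hflip
  rw [hflip]
  congr 1
  · ext i
    fin_cases i <;> simp [mulVec, dotProduct, Fin.sum_univ_two]
    ring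
  · ext i j
    fin_cases i <;> fin_cases j <;> simp [flipSign, mul_apply, Fin.sum_univ_two]

end Transformations

section Modular

variable {τ : Matrix (Fin 2) (Fin 2) ℂ}

lemma thetaTerm_fin_two (h : τ.IsSymm) (a₁ a₂ b₁ b₂ m n : ℤ) :
    thetaTerm ![a₁, a₂] ![b₁, b₂] τ ![m, n] =
      cexp (Real.pi * I * (τ 0 0 * (m + a₁ / 2) ^ 2 + 2 * τ 0 1 * (m + a₁ / 2) * (n + a₂ / 2) +
        τ 1 1 * (n + a₂ / 2) ^ 2 + b₁ * (m + a₁ / 2) + b₂ * (n + a₂ / 2))) := by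
  simp only [thetaTerm, dotProduct, mulVec, halfShift, Fin.sum_univ_two, cons_val_zero,
    cons_val_one, h.apply 0 1]
  ring_nf

lemma thetaSeries_eq_tsum_prod (a b : Fin 2 → ℤ) (τ : Matrix (Fin 2) (Fin 2) ℂ) :
    thetaSeries a b τ = ∑' m : ℤ × ℤ, thetaTerm a b τ ![m.1, m.2] :=
  ((finTwoArrowEquiv ℤ).symm.tsum_eq _).symm

lemma thetaSeries_eq_tsum_tsum (h : τ ∈ SiegelH2) (a b : Fin 2 → ℤ) :
    thetaSeries a b τ = ∑' n : ℤ, ∑' m : ℤ, thetaTerm a b τ ![m, n] := by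
  have hs := (summable_norm_thetaTerm h.2 a b).of_norm
  rw [← ((Equiv.prodComm ℤ ℤ).trans (finTwoArrowEquiv ℤ).symm).summable_iff] at hs
  rw [thetaSeries_eq_tsum_prod, ← (Equiv.prodComm ℤ ℤ).tsum_eq]
  exact hs.tsum_prod

lemma tsum_thetaTerm_partialInv (h : τ ∈ SiegelH2) (a₂ b₁ b₂ n : ℤ) :
    ∑' m : ℤ, thetaTerm ![0, a₂] ![b₁, b₂] (partialInv τ) ![m, n] =
      1 / (-I * (-1 / τ 0 0)) ^ (1 / 2 : ℂ) *
        ∑' m : ℤ, thetaTerm ![b₁, a₂] ![0, b₂] τ ![m, n] := by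
  have hz := ne_zero_of_mem_siegelH2 h
  obtain ⟨v, hv⟩ : ∃ v : ℂ, v = n + a₂ / 2 := ⟨_, rfl⟩
  let u : ℂ := -v * τ 0 1 / τ 0 0 + b₁ / 2
  let K : ℂ := cexp (Real.pi * I * ((τ 1 1 - τ 0 1 ^ 2 / τ 0 0) * v ^ 2 + b₂ * v))
  have hleft (m : ℤ) : thetaTerm ![0, a₂] ![b₁, b₂] (partialInv τ) ![m, n] =
      K * jacobiTheta₂_term m u (-1 / τ 0 0) := by
    rw [thetaTerm_fin_two (partialInv_mem_siegelH2 h).1, jacobiTheta₂_term, ← Complex.exp_add]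
    simp only [partialInv, of_apply, cons_val', cons_val_zero, cons_val_one, cons_val_fin_one,
      ← hv, u]
    push_cast
    field_simp
    ring_nf
  have hright (m : ℤ) : thetaTerm ![b₁, a₂] ![0, b₂] τ ![m - b₁, n] =
      K * (cexp (-Real.pi * I * u ^ 2 / (-1 / τ 0 0)) *
        jacobiTheta₂_term m (u / (-1 / τ 0 0)) (-1 / (-1 / τ 0 0))) := by
    rw [thetaTerm_fin_two h.1, jacobiTheta₂_term, ← Complex.exp_add, ← Complex.exp_add]
    simp only [← hv, u]
    push_cast
    congr 1
    field_simp
    ring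
  have hfun := jacobiTheta₂_functional_equation u (-1 / τ 0 0)
  simp only [jacobiTheta₂] at hfun
  rw [← (Equiv.subRight b₁).tsum_eq fun m => thetaTerm ![b₁, a₂] ![0, b₂] τ ![m, n]]
  simp only [Equiv.subRight_apply, hleft, hright, tsum_mul_left, hfun]
  ring

lemma exists_thetaSeries_partialInv (h : τ ∈ SiegelH2) :
    ∃ c : ℂ, c ≠ 0 ∧ ∀ a₂ b₁ b₂ : ℤ, thetaSeries ![0, a₂] ![b₁, b₂] (partialInv τ) =
      c * thetaSeries ![b₁, a₂] ![0, b₂] τ := by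
  refine ⟨1 / (-I * (-1 / τ 0 0)) ^ (1 / 2 : ℂ), ?_, fun a₂ b₁ b₂ => ?_⟩
  · refine one_div_ne_zero fun h0 => ?_
    simp [Complex.cpow_eq_zero_iff, ne_zero_of_mem_siegelH2 h] at h0
  · rw [thetaSeries_eq_tsum_tsum (partialInv_mem_siegelH2 h), thetaSeries_eq_tsum_tsum h,
      ← tsum_mul_left]
    simp only [tsum_thetaTerm_partialInv h]

lemma blockA_gammaOf {S : Matrix (Fin 2) (Fin 2) ℤ} (hS : Sᵀ = S) :
    blockA (gammaOf S hS) = -1 := by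
  ext i j
  fin_cases i <;> fin_cases j <;> simp [blockA, gammaOf]

lemma blockB_gammaOf {S : Matrix (Fin 2) (Fin 2) ℤ} (hS : Sᵀ = S) :
    blockB (gammaOf S hS) = -S.map (↑) := by
  ext i j
  simp [blockB, gammaOf]

lemma blockC_gammaOf {S : Matrix (Fin 2) (Fin 2) ℤ} (hS : Sᵀ = S) :
    blockC (gammaOf S hS) = S.map (↑) := rfl

lemma blockD_gammaOf {S : Matrix (Fin 2) (Fin 2) ℤ} (hS : Sᵀ = S) :
    blockD (gammaOf S hS) = (-1 + S ^ 2).map (↑) := rfl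

lemma spAct_gammaOf {S : Matrix (Fin 2) (Fin 2) ℤ} (hS : Sᵀ = S) {X : Matrix (Fin 2) (Fin 2) ℂ}
    (hdet : (S.map (Int.cast : ℤ → ℂ) * τ + (-1 + S ^ 2).map (↑)).det ≠ 0)
    (hX : X * (S.map (Int.cast : ℤ → ℂ) * τ + (-1 + S ^ 2).map (↑)) = -τ - S.map (↑)) :
    spAct (gammaOf S hS) τ = X := by
  rw [spAct, blockA_gammaOf, blockB_gammaOf, blockC_gammaOf, blockD_gammaOf, neg_one_mul,
    ← sub_eq_add_neg, ← hX, mul_nonsing_inv_cancel_right _ _ hdet.isUnit]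

lemma spAct_one (τ : Matrix (Fin 2) (Fin 2) ℂ) : spAct 1 τ = τ := by
  have hA : blockA 1 = 1 := by
    ext i j
    fin_cases i <;> fin_cases j <;> simp [blockA, toBlocks₁₁]
  have hB : blockB 1 = 0 := by
    ext i j
    fin_cases i <;> fin_cases j <;> simp [blockB, toBlocks₁₂]
  have hC : blockC 1 = 0 := by
    ext i j
    fin_cases i <;> fin_cases j <;> simp [blockC, toBlocks₂₁]
  have hD : blockD 1 = 1 := by
    ext i j
    fin_cases i <;> fin_cases j <;> simp [blockD, toBlocks₂₂]
  simp [spAct, hA, hB, hC, hD]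

lemma spAct_gamma_one (h : τ ∈ SiegelH2) :
    spAct (gamma 1) τ = partialInv τ - (!![1, 0; 0, 0] : Matrix (Fin 2) (Fin 2) ℤ).map (↑) := by
  have hz := ne_zero_of_mem_siegelH2 h
  refine spAct_gammaOf (by decide) ?_ ?_
  · rw [det_fin_two]
    simpa [mul_apply, Fin.sum_univ_two, pow_two] using hz
  · ext i j
    fin_cases i <;> fin_cases j <;>
      simp [partialInv, mul_apply, Fin.sum_univ_two, pow_two, h.1.apply 0 1] <;> field_simp <;> ring

lemma spAct_gamma_two (h : τ ∈ SiegelH2) :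
    spAct (gamma 2) τ = swapVars (spAct (gamma 1) (swapVars τ)) := by
  have hz := ne_zero_of_mem_siegelH2 (swapVars_mem_siegelH2 h)
  rw [spAct_gamma_one (swapVars_mem_siegelH2 h)]
  simp only [swapVars, of_apply, cons_val', cons_val_zero, cons_val_fin_one] at hz
  refine spAct_gammaOf (by decide) ?_ ?_
  · rw [det_fin_two]
    simpa [mul_apply, Fin.sum_univ_two, pow_two] using hz
  · ext i j
    fin_cases i <;> fin_cases j <;>
      simp [partialInv, swapVars, mul_apply, Fin.sum_univ_two, pow_two, h.1.apply 0 1] <;>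
      field_simp <;> ring

lemma spAct_gamma_three (h : τ ∈ SiegelH2) :
    spAct (gamma 3) τ = partialInv (swapVars (partialInv τ)) -
      (!![0, 1; 1, 0] : Matrix (Fin 2) (Fin 2) ℤ).map (↑) := by
  have hz := ne_zero_of_mem_siegelH2 h
  have hz' := ne_zero_of_mem_siegelH2 (swapVars_mem_siegelH2 (partialInv_mem_siegelH2 h))
  simp only [swapVars, partialInv, of_apply, cons_val', cons_val_zero, cons_val_one,
    cons_val_fin_one] at hz'
  have hdet : τ 1 1 * τ 0 0 - τ 0 1 ^ 2 ≠ 0 := by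
    have := mul_ne_zero hz' hz
    rwa [sub_mul, div_mul_cancel₀ _ hz] at this
  have hdet' : τ 0 0 * τ 1 1 - τ 0 1 ^ 2 ≠ 0 := by rwa [mul_comm]
  refine spAct_gammaOf (by decide) ?_ ?_
  · rw [det_fin_two]
    have : τ 0 1 * τ 0 1 - τ 1 1 * τ 0 0 ≠ 0 := by
      contrapose! hdet
      linear_combination -hdet
    simpa [mul_apply, Fin.sum_univ_two, pow_two, h.1.apply 0 1] using this
  · ext i j
    fin_cases i <;> fin_cases j <;>
      simp [partialInv, swapVars, mul_apply, Fin.sum_univ_two, pow_two, h.1.apply 0 1] <;>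
      field_simp <;> ring

lemma exists_thetaSeries_spAct_gamma_one (h : τ ∈ SiegelH2) :
    ∃ c : ℂ, c ≠ 0 ∧ ∀ b₁ b₂ : ℤ, thetaSeries 0 ![b₁, b₂] (spAct (gamma 1) τ) =
      c * thetaSeries ![1 - b₁, 0] ![0, b₂] τ := by
  obtain ⟨c, hc, hinv⟩ := exists_thetaSeries_partialInv h
  refine ⟨c, hc, fun b₁ b₂ => ?_⟩
  have hmod (i : Fin 2) : ![b₁, b₂] i ≡ ![1 - b₁, b₂] i + !![1, 0; 0, 0] i i [ZMOD 2] := by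
    fin_cases i <;> simp [Int.modEq_iff_dvd]
    omega
  rw [spAct_gamma_one h, thetaSeries_zero_sub_intCast (isSymm_fin_two_iff.2 rfl) hmod, ← hinv]
  congr 1
  ext i
  fin_cases i <;> rfl

lemma exists_thetaSeries_spAct_gamma_two (h : τ ∈ SiegelH2) :
    ∃ c : ℂ, c ≠ 0 ∧ ∀ b₁ b₂ : ℤ, thetaSeries 0 ![b₁, b₂] (spAct (gamma 2) τ) =
      c * thetaSeries ![0, 1 - b₂] ![b₁, 0] τ := by
  obtain ⟨c, hc, h1⟩ := exists_thetaSeries_spAct_gamma_one (swapVars_mem_siegelH2 h)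
  refine ⟨c, hc, fun b₁ b₂ => ?_⟩
  have hzero : (![(0 : Fin 2 → ℤ) 1, (0 : Fin 2 → ℤ) 0]) = 0 := by simp
  rw [spAct_gamma_two h, thetaSeries_swapVars, hzero]
  exact (h1 b₂ b₁).trans (congrArg (c * ·) (thetaSeries_swapVars _ _ τ))

lemma exists_thetaSeries_spAct_gamma_three (h : τ ∈ SiegelH2) :
    ∃ c : ℂ, c ≠ 0 ∧ ∀ b₁ b₂ : ℤ, thetaSeries 0 ![b₁, b₂] (spAct (gamma 3) τ) =
      c * thetaSeries ![b₂, b₁] 0 τ := by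
  obtain ⟨c, hc, hinv⟩ := exists_thetaSeries_partialInv h
  obtain ⟨d, hd, hinv'⟩ :=
    exists_thetaSeries_partialInv (swapVars_mem_siegelH2 (partialInv_mem_siegelH2 h))
  refine ⟨d * c, mul_ne_zero hd hc, fun b₁ b₂ => ?_⟩
  have hmod (i : Fin 2) : ![b₁, b₂] i ≡ ![b₁, b₂] i + !![0, 1; 1, 0] i i [ZMOD 2] := by
    fin_cases i <;> simp
  rw [spAct_gamma_three h, thetaSeries_zero_sub_intCast (isSymm_fin_two_iff.2 rfl) hmod,
    zero_eq_vec, hinv', thetaSeries_swapVars]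
  exact (congrArg (d * ·) (hinv b₁ b₂ 0)).trans (mul_assoc d c _).symm

lemma spAct_gamma_mem_siegelH2 (h : τ ∈ SiegelH2) (k : Fin 4) : spAct (gamma k) τ ∈ SiegelH2 := by
  have hone {σ : Matrix (Fin 2) (Fin 2) ℂ} (hσ : σ ∈ SiegelH2) : spAct (gamma 1) σ ∈ SiegelH2 := by
    rw [spAct_gamma_one hσ]
    exact sub_intCast_mem_siegelH2 (partialInv_mem_siegelH2 hσ) (isSymm_fin_two_iff.2 rfl)
  fin_cases k
  · exact (spAct_one τ).symm ▸ h
  · exact hone h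
  · exact (spAct_gamma_two h).symm ▸ swapVars_mem_siegelH2 (hone (swapVars_mem_siegelH2 h))
  · exact (spAct_gamma_three h).symm ▸ sub_intCast_mem_siegelH2
      (partialInv_mem_siegelH2 (swapVars_mem_siegelH2 (partialInv_mem_siegelH2 h)))
      (isSymm_fin_two_iff.2 rfl)

lemma continuous_swapVars : Continuous swapVars := by
  unfold swapVars
  fun_prop

lemma continuousOn_partialInv : ContinuousOn partialInv SiegelH2 := by
  intro τ h
  have hz := ne_zero_of_mem_siegelH2 h
  have hentry (i j : Fin 2) : ContinuousAt (fun σ : Matrix (Fin 2) (Fin 2) ℂ => σ i j) τ :=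
    (continuous_id.matrix_elem i j).continuousAt
  refine ContinuousAt.continuousWithinAt
    (continuousAt_pi.2 fun i => continuousAt_pi.2 fun j => ?_)
  fin_cases i <;> fin_cases j
  · exact continuousAt_const.div (hentry 0 0) hz
  · exact (hentry 0 1).neg.div (hentry 0 0) hz
  · exact (hentry 1 0).neg.div (hentry 0 0) hz
  · exact (hentry 1 1).sub (((hentry 0 1).pow 2).div (hentry 0 0) hz)

lemma continuousOn_spAct_gamma (k : Fin 4) : ContinuousOn (spAct (gamma k)) SiegelH2 := by
  have hone : ContinuousOn (spAct (gamma 1)) SiegelH2 :=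
    (continuousOn_partialInv.sub continuousOn_const).congr fun _ h => spAct_gamma_one h
  fin_cases k
  · exact continuousOn_id.congr fun τ _ => spAct_one τ
  · exact hone
  · exact (continuous_swapVars.comp_continuousOn (hone.comp continuous_swapVars.continuousOn
      fun _ h => swapVars_mem_siegelH2 h)).congr fun _ h => spAct_gamma_two h
  · exact ((continuousOn_partialInv.comp
      (continuous_swapVars.comp_continuousOn continuousOn_partialInv)
      fun _ h => swapVars_mem_siegelH2 (partialInv_mem_siegelH2 h)).sub continuousOn_const).congr
        fun _ h => spAct_gamma_three h

end Modular

section Tail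

lemma hasSum_pow_natAbs {r : ℝ} (h₀ : 0 ≤ r) (h₁ : r < 1) :
    HasSum (fun n : ℤ => r ^ n.natAbs) ((1 + r) / (1 - r)) := by
  have hg := hasSum_geometric_of_lt_one h₀ h₁
  have hneg (n : ℕ) : r ^ (-((n : ℤ) + 1)).natAbs = r * r ^ n := by
    rw [← pow_succ', show (-((n : ℤ) + 1)).natAbs = n + 1 by omega]
  convert HasSum.of_nat_of_neg_add_one (f := fun n : ℤ => r ^ n.natAbs) (by simpa using hg)
    (by simpa only [hneg] using hg.mul_left r) using 1
  field_simp

lemma hasSum_pow_natAbs_add_natAbs {r : ℝ} (h₀ : 0 ≤ r) (h₁ : r < 1) :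
    HasSum (fun m : ℤ × ℤ => r ^ (m.1.natAbs + m.2.natAbs)) (((1 + r) / (1 - r)) ^ 2) := by
  have hsum := hasSum_pow_natAbs h₀ h₁
  have hnn (n : ℤ) : 0 ≤ r ^ n.natAbs := pow_nonneg h₀ _
  simpa only [pow_add, pow_two] using
    hsum.mul hsum (hsum.summable.mul_of_nonneg hsum.summable hnn hnn)

variable {V : Type*} [NormedAddCommGroup V]

lemma norm_tsum_sub_sum_le {f : ℤ × ℤ → V} {E : ℤ × ℤ → ℕ} {S B : Finset (ℤ × ℤ)} {p p₀ : ℝ}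
    {c N : ℕ} (hp : 0 ≤ p) (hpp : p ≤ p₀) (hp₀ : p₀ < 1) (hs : Summable f)
    (hf : ∀ m, ‖f m‖ ≤ p ^ E m) (hB : ∀ m ∈ B \ S, c ≤ E m)
    (hN : ∀ m ∉ B, N + (m.1.natAbs + m.2.natAbs) ≤ E m) (hc : c ≤ N) :
    ‖∑' m, f m - ∑ m ∈ S, f m‖ ≤
      p ^ c * (∑ m ∈ B \ S, p₀ ^ (E m - c) + p₀ ^ (N - c) * ((1 + p₀) / (1 - p₀)) ^ 2) := by
  have hpow {n : ℕ} (hn : c ≤ n) : p ^ n ≤ p ^ c * p₀ ^ (n - c) := by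
    rw [← pow_mul_pow_sub p hn]
    gcongr
  have hsplit : ∑' m, f m - ∑ m ∈ S, f m =
      ∑ m ∈ B \ S, f m + ∑' m : ↥((S ∪ B : Finset (ℤ × ℤ)) : Set (ℤ × ℤ))ᶜ, f m := by
    rw [← hs.sum_add_tsum_compl (s := S ∪ B), ← Finset.union_sdiff_self_eq_union,
      Finset.sum_union Finset.disjoint_sdiff]
    abel
  have hbox : ‖∑ m ∈ B \ S, f m‖ ≤ p ^ c * ∑ m ∈ B \ S, p₀ ^ (E m - c) := by
    rw [Finset.mul_sum]
    exact norm_sum_le_of_le _ fun m hm => (hf m).trans (hpow (hB m hm))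
  have hgeo := (hasSum_pow_natAbs_add_natAbs (hp.trans hpp) hp₀).mul_left (p ^ c * p₀ ^ (N - c))
  have hp₀' := hp.trans hpp
  have hnn (m : ℤ × ℤ) : 0 ≤ p ^ c * p₀ ^ (N - c) * p₀ ^ (m.1.natAbs + m.2.natAbs) := by
    positivity
  have htail : ‖∑' m : ↥((S ∪ B : Finset (ℤ × ℤ)) : Set (ℤ × ℤ))ᶜ, f m‖ ≤
      p ^ c * p₀ ^ (N - c) * ((1 + p₀) / (1 - p₀)) ^ 2 := by
    rw [← hgeo.tsum_eq]
    refine (tsum_of_norm_bounded (hgeo.summable.subtype _).hasSum fun m => ?_).trans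
      (hgeo.summable.tsum_subtype_le _ _ hnn)
    have hm := hN m fun hm => m.2 (Finset.mem_union_right S hm)
    refine (hf m).trans ((pow_le_pow_of_le_one hp (hpp.trans hp₀.le) hm).trans ?_)
    rw [Function.comp_apply, mul_assoc, ← pow_add, ← Nat.sub_add_comm hc]
    exact hpow (hc.trans (Nat.le_add_right N _))
  rw [hsplit, mul_add, ← mul_assoc]
  exact (norm_add_le _ _).trans (add_le_add hbox htail)

end Tail

section Reduced

/-- Symmetric matrices whose imaginary part is reduced in the sense of Minkowski with non-negative
off-diagonal entry, and has minimum at least `y`. -/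
structure IsMinkowskiReduced (y : ℝ) (τ : Matrix (Fin 2) (Fin 2) ℂ) : Prop where
  isSymm : τ.IsSymm
  sqrt_three_le : √3 / 2 ≤ y
  le_zero_zero : y ≤ (τ 0 0).im
  le_one_one : y ≤ (τ 1 1).im
  nonneg : 0 ≤ (τ 0 1).im
  two_mul_le : 2 * (τ 0 1).im ≤ y

variable {y : ℝ} {τ : Matrix (Fin 2) (Fin 2) ℂ}

lemma IsMinkowskiReduced.mem_siegelH2 (h : IsMinkowskiReduced y τ) : τ ∈ SiegelH2 := by
  have hy : 0 < y := lt_of_lt_of_le (by positivity) h.sqrt_three_le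
  rw [mem_siegelH2_iff]
  refine ⟨h.isSymm, hy.trans_le h.le_zero_zero, ?_⟩
  have := mul_le_mul h.le_zero_zero h.le_one_one hy.le (hy.le.trans h.le_zero_zero)
  nlinarith [h.nonneg, h.two_mul_le]

lemma IsMinkowskiReduced.swapVars (h : IsMinkowskiReduced y τ) :
    IsMinkowskiReduced y (swapVars τ) where
  isSymm := (swapVars_mem_siegelH2 h.mem_siegelH2).1
  sqrt_three_le := h.sqrt_three_le
  le_zero_zero := h.le_one_one
  le_one_one := h.le_zero_zero
  nonneg := by simpa [SiegelTheta.swapVars, h.isSymm.apply 0 1] using h.nonneg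
  two_mul_le := by simpa [SiegelTheta.swapVars, h.isSymm.apply 0 1] using h.two_mul_le

/-- The quantity `exp (-π y / 2)`, in powers of which the theta constants are expanded. -/
noncomputable def nome (y : ℝ) : ℝ := Real.exp (-Real.pi * y / 2)

lemma nome_pos (y : ℝ) : 0 < nome y := Real.exp_pos _

lemma nome_le (h : √3 / 2 ≤ y) : nome y ≤ 257 / 1000 := by
  have hsqrt : (1.732 : ℝ) ≤ √3 := Real.le_sqrt_of_sq_le (by norm_num)
  have harg : (1.36 : ℝ) ≤ Real.pi * y / 2 := by nlinarith [Real.pi_gt_d4]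
  have hexp : (1000 / 257 : ℝ) ≤ Real.exp (Real.pi * y / 2) := by
    refine le_trans ?_ (Real.exp_le_exp.2 harg)
    refine le_trans ?_ (Real.sum_le_exp_of_nonneg (by norm_num) 9)
    norm_num [Finset.sum_range_succ, Nat.factorial]
  rw [nome, show -Real.pi * y / 2 = -(Real.pi * y / 2) by ring, Real.exp_neg,
    inv_le_comm₀ (Real.exp_pos _) (by norm_num)]
  simpa using hexp

lemma exp_neg_pi_mul_le {X : ℝ} {E : ℤ} (hE : 0 ≤ E) (h : y / 2 * E ≤ X) :
    Real.exp (-Real.pi * X) ≤ nome y ^ E.toNat := by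
  have hE' : ((E.toNat : ℕ) : ℝ) = E := by exact_mod_cast Int.toNat_of_nonneg hE
  rw [nome, ← Real.exp_nat_mul, Real.exp_le_exp, hE']
  nlinarith [Real.pi_pos]

/-- For `a₁, a₂ ∈ {0, 1}`, the exponent of `nome y` in the bound for the `m`-th term of the theta
series with characteristic `(a₁, a₂)` divided by the leading term. The minimum accounts for the
extreme values `0` and `y / 2` of the off-diagonal entry of a reduced imaginary part. -/
def expForm (a₁ a₂ : ℤ) (m : ℤ × ℤ) : ℤ :=
  2 * (m.1 ^ 2 + a₁ * m.1 + m.2 ^ 2 + a₂ * m.2) +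
    min 0 (2 * m.1 * m.2 + a₂ * m.1 + a₁ * m.2 + a₁ * a₂)

lemma sq_sub_abs_nonneg (m : ℤ) : 0 ≤ m ^ 2 - |m| := by
  rw [← sq_abs]
  rcases (abs_nonneg m).eq_or_lt with h | h
  · simp [← h]
  · nlinarith [show 1 ≤ |m| from h]

lemma sq_sub_abs_le_sq_add {a : ℤ} (ha : a = 0 ∨ a = 1) (m : ℤ) :
    m ^ 2 - |m| ≤ m ^ 2 + a * m := by
  rcases ha with rfl | rfl <;> linarith [neg_abs_le m, abs_nonneg m]

lemma sq_sub_abs_add_le_expForm {a₁ a₂ : ℤ} (h₁ : a₁ = 0 ∨ a₁ = 1) (h₂ : a₂ = 0 ∨ a₂ = 1)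
    (m : ℤ × ℤ) : (m.1 ^ 2 - |m.1|) + (m.2 ^ 2 - |m.2|) ≤ expForm a₁ a₂ m := by
  have hm₁ := sq_sub_abs_le_sq_add h₁ m.1
  have hm₂ := sq_sub_abs_le_sq_add h₂ m.2
  have hprod : 0 ≤ (m.1 + m.2 + a₁) * (m.1 + m.2 + a₂) := by
    have hle (n : ℤ) : 0 ≤ n * (n + 1) := by
      nlinarith [sq_sub_abs_nonneg n, neg_abs_le n]
    rcases h₁ with rfl | rfl <;> rcases h₂ with rfl | rfl
    · nlinarith
    · nlinarith [hle (m.1 + m.2)]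
    · nlinarith [hle (m.1 + m.2)]
    · nlinarith
  rw [expForm]
  rcases min_choice 0 (2 * m.1 * m.2 + a₂ * m.1 + a₁ * m.2 + a₁ * a₂) with h | h <;> rw [h]
  · linarith [sq_sub_abs_nonneg m.1, sq_sub_abs_nonneg m.2]
  · nlinarith

/-- The finite box of indices on which the terms of the theta series are estimated one by one. -/
noncomputable def box : Finset (ℤ × ℤ) := Finset.Icc (-3) 3 ×ˢ Finset.Icc (-3) 3

lemma le_expForm_of_notMem_box {a₁ a₂ : ℤ} (h₁ : a₁ = 0 ∨ a₁ = 1) (h₂ : a₂ = 0 ∨ a₂ = 1)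
    {m : ℤ × ℤ} (hm : m ∉ box) : 6 + (m.1.natAbs + m.2.natAbs) ≤ (expForm a₁ a₂ m).toNat := by
  have hlarge : 4 ≤ |m.1| ∨ 4 ≤ |m.2| := by
    by_contra! hcon
    refine hm (Finset.mem_product.2 ⟨Finset.mem_Icc.2 ?_, Finset.mem_Icc.2 ?_⟩) <;>
    · rw [← abs_le]
      omega
  have hle : 6 + |m.1| + |m.2| ≤ expForm a₁ a₂ m := by
    have := sq_sub_abs_add_le_expForm h₁ h₂ m
    rw [← sq_abs m.1, ← sq_abs m.2] at this
    rcases hlarge with h | h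
    · nlinarith [sq_nonneg (|m.2| - 1)]
    · nlinarith [sq_nonneg (|m.1| - 1)]
  rw [← Int.natCast_natAbs m.1, ← Int.natCast_natAbs m.2] at hle
  omega

lemma mul_min_le_mul {s t : ℝ} (ht : 0 ≤ t) (hts : t ≤ s) (k : ℝ) : s * min 0 k ≤ t * k := by
  rcases le_total 0 k with h | h
  · rw [min_eq_left h, mul_zero]
    positivity
  · rw [min_eq_right h]
    exact mul_le_mul_of_nonpos_right hts h

/-- The exponent of the leading term of the theta series with characteristic `(a₁, a₂)`, where
`a₁, a₂ ∈ {0, 1}`. -/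
noncomputable def leadForm (a₁ a₂ : ℤ) (τ : Matrix (Fin 2) (Fin 2) ℂ) : ℂ :=
  (a₁ * τ 0 0 + a₂ * τ 1 1 - 2 * (a₁ * a₂) * τ 0 1) / 4

/-- The terms of the theta series divided by the leading one. -/
noncomputable def normTerm (a₁ a₂ b₁ b₂ : ℤ) (τ : Matrix (Fin 2) (Fin 2) ℂ) (m : ℤ × ℤ) : ℂ :=
  thetaTerm ![a₁, a₂] ![b₁, b₂] τ ![m.1, m.2] / cexp (Real.pi * I * leadForm a₁ a₂ τ)

lemma normTerm_eq (h : τ.IsSymm) {a₁ a₂ : ℤ} (h₁ : a₁ = 0 ∨ a₁ = 1) (h₂ : a₂ = 0 ∨ a₂ = 1)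
    (b₁ b₂ : ℤ) (m : ℤ × ℤ) :
    normTerm a₁ a₂ b₁ b₂ τ m =
      cexp (Real.pi * I * (τ 0 0 * (m.1 ^ 2 + a₁ * m.1 : ℤ) + τ 1 1 * (m.2 ^ 2 + a₂ * m.2 : ℤ) +
        τ 0 1 * (2 * m.1 * m.2 + a₂ * m.1 + a₁ * m.2 + a₁ * a₂ : ℤ) +
        (b₁ * (m.1 + a₁ / 2) + b₂ * (m.2 + a₂ / 2)))) := by
  rw [normTerm, thetaTerm_fin_two h, ← Complex.exp_sub, leadForm]
  congr 1
  rcases h₁ with rfl | rfl <;> rcases h₂ with rfl | rfl <;> push_cast <;> ring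

lemma norm_normTerm_le (h : IsMinkowskiReduced y τ) {a₁ a₂ : ℤ} (h₁ : a₁ = 0 ∨ a₁ = 1)
    (h₂ : a₂ = 0 ∨ a₂ = 1) (b₁ b₂ : ℤ) (m : ℤ × ℤ) :
    ‖normTerm a₁ a₂ b₁ b₂ τ m‖ ≤ nome y ^ (expForm a₁ a₂ m).toNat := by
  have hm₁ := (sq_sub_abs_nonneg m.1).trans (sq_sub_abs_le_sq_add h₁ m.1)
  have hm₂ := (sq_sub_abs_nonneg m.2).trans (sq_sub_abs_le_sq_add h₂ m.2)
  have him : ((b₁ * (m.1 + a₁ / 2) + b₂ * (m.2 + a₂ / 2) : ℂ)).im = 0 := by simp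
  rw [normTerm_eq h.isSymm h₁ h₂, norm_cexp_pi_mul_I_mul]
  refine exp_neg_pi_mul_le ((add_nonneg (sq_sub_abs_nonneg _) (sq_sub_abs_nonneg _)).trans
    (sq_sub_abs_add_le_expForm h₁ h₂ m)) ?_
  have hmin := mul_min_le_mul h.nonneg (s := y / 2) (by linarith [h.two_mul_le])
    ((2 * m.1 * m.2 + a₂ * m.1 + a₁ * m.2 + a₁ * a₂ : ℤ) : ℝ)
  have hle₁ := mul_le_mul_of_nonneg_right h.le_zero_zero (Int.cast_nonneg (R := ℝ) hm₁)
  have hle₂ := mul_le_mul_of_nonneg_right h.le_one_one (Int.cast_nonneg (R := ℝ) hm₂)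
  rw [Complex.add_im, him, add_zero]
  simp only [Complex.add_im, ← Complex.ofReal_intCast, Complex.im_mul_ofReal, expForm]
  push_cast at hmin hle₁ hle₂ ⊢
  linarith

lemma norm_tsum_normTerm_sub_sum_le (h : IsMinkowskiReduced y τ) {a₁ a₂ : ℤ}
    (h₁ : a₁ = 0 ∨ a₁ = 1) (h₂ : a₂ = 0 ∨ a₂ = 1) (b₁ b₂ : ℤ) {S : Finset (ℤ × ℤ)} {c : ℕ} {C : ℚ}
    (hc : c ≤ 6) (hE : ∀ m ∈ box \ S, c ≤ (expForm a₁ a₂ m).toNat)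
    (hC : ∑ m ∈ box \ S, (257 / 1000 : ℚ) ^ ((expForm a₁ a₂ m).toNat - c) +
      3 * (257 / 1000) ^ (6 - c) ≤ C) :
    ‖∑' m, normTerm a₁ a₂ b₁ b₂ τ m - ∑ m ∈ S, normTerm a₁ a₂ b₁ b₂ τ m‖ ≤ nome y ^ c * C := by
  have hs : Summable (normTerm a₁ a₂ b₁ b₂ τ) :=
    (((finTwoArrowEquiv ℤ).symm.summable_iff.2
      (summable_norm_thetaTerm h.mem_siegelH2.2 ![a₁, a₂] ![b₁, b₂]).of_norm)).div_const _
  refine (norm_tsum_sub_sum_le (nome_pos y).le (nome_le h.sqrt_three_le) (by norm_num) hs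
    (norm_normTerm_le h h₁ h₂ b₁ b₂) hE (fun m => le_expForm_of_notMem_box h₁ h₂) hc).trans ?_
  have hC' : (∑ m ∈ box \ S, (257 / 1000) ^ ((expForm a₁ a₂ m).toNat - c) +
      3 * (257 / 1000) ^ (6 - c) : ℝ) ≤ C := by
    have := (Rat.cast_le (K := ℝ)).2 hC
    push_cast at this
    exact this
  have hgeo : ((1 + 257 / 1000) / (1 - 257 / 1000) : ℝ) ^ 2 ≤ 3 := by norm_num
  refine mul_le_mul_of_nonneg_left (le_trans ?_ hC') (pow_nonneg (nome_pos y).le c)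
  rw [mul_comm (3 : ℝ)]
  gcongr

lemma thetaSeries_eq_mul_tsum_normTerm (a₁ a₂ b₁ b₂ : ℤ) (τ : Matrix (Fin 2) (Fin 2) ℂ) :
    thetaSeries ![a₁, a₂] ![b₁, b₂] τ =
      cexp (Real.pi * I * leadForm a₁ a₂ τ) * ∑' m, normTerm a₁ a₂ b₁ b₂ τ m := by
  simp only [normTerm, tsum_div_const, ← thetaSeries_eq_tsum_prod]
  field_simp [Complex.exp_ne_zero]

end Reduced

lemma cexp_pi_mul_I_mul_eq (z : ℂ) :
    cexp (Real.pi * I * z) =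
      (Real.exp (-Real.pi * z.im) : ℝ) * cexp ((Real.pi * z.re : ℝ) * I) := by
  rw [Complex.ofReal_exp, ← Complex.exp_add]
  congr 1
  apply Complex.ext <;> simp

section Expansions

variable {y : ℝ} {τ : Matrix (Fin 2) (Fin 2) ℂ}

lemma norm_thetaSeries_zero_zero_sub_one_le (h : IsMinkowskiReduced y τ) (b₁ b₂ : ℤ) :
    ‖thetaSeries ![0, 0] ![b₁, b₂] τ - 1‖ ≤ 41 / 100 := by
  have key := norm_tsum_normTerm_sub_sum_le h (.inl rfl) (.inl rfl) b₁ b₂ (S := {(0, 0)}) (c := 0)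
    (C := 41 / 100) (by norm_num) (fun _ _ => Nat.zero_le _) (by decide +kernel)
  rw [Finset.sum_singleton, normTerm_eq h.isSymm (.inl rfl) (.inl rfl)] at key
  simpa [thetaSeries_eq_mul_tsum_normTerm, leadForm] using key

lemma exists_thetaSeries_zero_zero_eq (h : IsMinkowskiReduced y τ) :
    ∃ ρ : ℂ, ‖ρ‖ ≤ nome y ^ 4 * (26 / 10) ∧
      thetaSeries ![0, 0] ![0, 0] τ = 1 + 2 * cexp (Real.pi * I * τ 0 0) +
        2 * cexp (Real.pi * I * τ 1 1) + 2 * cexp (Real.pi * I * (τ 0 0 + τ 1 1 - 2 * τ 0 1)) +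
        ρ := by
  let S : Finset (ℤ × ℤ) := {(0, 0), (1, 0), (-1, 0), (0, 1), (0, -1), (1, -1), (-1, 1)}
  have key := norm_tsum_normTerm_sub_sum_le h (.inl rfl) (.inl rfl) 0 0 (S := S) (c := 4)
    (C := 26 / 10) (by norm_num) (by decide +kernel) (by decide +kernel)
  have hsum : ∑ m ∈ S, normTerm 0 0 0 0 τ m = 1 + 2 * cexp (Real.pi * I * τ 0 0) +
      2 * cexp (Real.pi * I * τ 1 1) + 2 * cexp (Real.pi * I * (τ 0 0 + τ 1 1 - 2 * τ 0 1)) := by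
    have hneg : τ 0 0 + τ 1 1 + -(τ 0 1 * 2) = τ 0 0 + τ 1 1 - 2 * τ 0 1 := by ring
    simp only [S, normTerm_eq h.isSymm (.inl rfl) (.inl rfl)]
    norm_num [hneg]
    ring
  rw [hsum] at key
  push_cast at key
  refine ⟨_, key, ?_⟩
  rw [thetaSeries_eq_mul_tsum_normTerm, leadForm]
  norm_num

lemma exists_thetaSeries_eq_mul_add {a₁ a₂ b₁ b₂ : ℤ} {L : ℂ} {δ : ℝ}
    (h : ‖∑' m, normTerm a₁ a₂ b₁ b₂ τ m - 2 * L‖ ≤ 2 * δ) :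
    ∃ c : ℝ, 0 < c ∧ ∃ ε : ℂ, ‖ε‖ ≤ δ ∧
      thetaSeries ![a₁, a₂] ![b₁, b₂] τ =
        c * (cexp ((Real.pi * (leadForm a₁ a₂ τ).re : ℝ) * I) * (L + ε)) := by
  refine ⟨2 * Real.exp (-Real.pi * (leadForm a₁ a₂ τ).im), by positivity,
    (∑' m, normTerm a₁ a₂ b₁ b₂ τ m - 2 * L) / 2, ?_, ?_⟩
  · rw [norm_div, Complex.norm_ofNat]
    linarith
  · rw [thetaSeries_eq_mul_tsum_normTerm, cexp_pi_mul_I_mul_eq]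
    push_cast
    ring

lemma exists_thetaSeries_one_zero_eq (h : IsMinkowskiReduced y τ) (b₂ : ℤ) :
    ∃ c : ℝ, 0 < c ∧ ∃ η : ℂ, ‖η‖ ≤ 34 / 25 * nome y ∧
      thetaSeries ![1, 0] ![0, b₂] τ =
        c * (cexp ((Real.pi * (leadForm 1 0 τ).re : ℝ) * I) * (1 + η)) := by
  have key := norm_tsum_normTerm_sub_sum_le h (.inr rfl) (.inl rfl) 0 b₂
    (S := {(0, 0), (-1, 0)}) (c := 1) (C := 68 / 25) (by norm_num) (by decide +kernel)
    (by decide +kernel)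
  have hsum : ∑ m ∈ {(0, 0), (-1, 0)}, normTerm 1 0 0 b₂ τ m = 2 * 1 := by
    rw [Finset.sum_pair (by decide), normTerm_eq h.isSymm (.inr rfl) (.inl rfl),
      normTerm_eq h.isSymm (.inr rfl) (.inl rfl)]
    norm_num
  rw [hsum] at key
  refine exists_thetaSeries_eq_mul_add (key.trans_eq ?_)
  push_cast
  ring

lemma exists_thetaSeries_one_one_eq (h : IsMinkowskiReduced y τ) :
    ∃ c : ℝ, 0 < c ∧ ∃ ε : ℂ, ‖ε‖ ≤ 57 / 20 * nome y ^ 3 ∧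
      thetaSeries ![1, 1] ![0, 0] τ = c * (cexp ((Real.pi * (leadForm 1 1 τ).re : ℝ) * I) *
        (1 + cexp (Real.pi * I * τ 0 1) + ε)) := by
  have key := norm_tsum_normTerm_sub_sum_le h (.inr rfl) (.inr rfl) 0 0
    (S := {(0, 0), (-1, -1), (0, -1), (-1, 0)}) (c := 3) (C := 57 / 10) (by norm_num)
    (by decide +kernel) (by decide +kernel)
  have hsum : ∑ m ∈ {(0, 0), (-1, -1), (0, -1), (-1, 0)}, normTerm 1 1 0 0 τ m =
      2 * (1 + cexp (Real.pi * I * τ 0 1)) := by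
    rw [Finset.sum_insert (by decide), Finset.sum_insert (by decide), Finset.sum_pair (by decide)]
    simp only [normTerm_eq h.isSymm (.inr rfl) (.inr rfl)]
    norm_num
    ring
  rw [hsum] at key
  refine exists_thetaSeries_eq_mul_add (key.trans_eq ?_)
  push_cast
  ring

end Expansions

section Cosine

lemma cos_pi_mul_le_of_abs_le {t c : ℝ} (h : |t| ≤ c) (hc : c ≤ 1) :
    Real.cos (Real.pi * c) ≤ Real.cos (Real.pi * t) := by
  rw [← Real.cos_abs (Real.pi * t), abs_mul, abs_of_pos Real.pi_pos]
  exact Real.cos_le_cos_of_nonneg_of_le_pi (by positivity)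
    (mul_le_of_le_one_right Real.pi_pos.le hc) (mul_le_mul_of_nonneg_left h Real.pi_pos.le)

lemma cos_pi_mul_nonneg_of_abs_le {t : ℝ} (h : |t| ≤ 1 / 2) : 0 ≤ Real.cos (Real.pi * t) := by
  have := cos_pi_mul_le_of_abs_le h (by norm_num)
  rwa [mul_one_div, Real.cos_pi_div_two] at this

lemma lt_cos_pi_mul_of_abs_le {t : ℝ} (h : |t| ≤ 3 / 8) :
    381 / 1000 < Real.cos (Real.pi * t) := by
  refine lt_of_lt_of_le ?_ (cos_pi_mul_le_of_abs_le h (by norm_num))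
  have hcos : Real.cos (Real.pi * (3 / 8)) = √(2 - √2) / 2 := by
    rw [← Real.sin_pi_div_eight, ← Real.cos_pi_div_two_sub]
    congr 1
    ring
  have h₂ : √2 ≤ 1.4143 := by
    rw [Real.sqrt_le_left (by norm_num)]
    norm_num
  have h₃ : (0.765 : ℝ) ≤ √(2 - √2) := Real.le_sqrt_of_sq_le (by norm_num; linarith)
  norm_num at h₃
  linarith

lemma one_le_cos_add_cos {s t : ℝ} (h₁ : |s + t| ≤ 1 / 2) (h₂ : |s - t| ≤ 1 / 2) :
    1 ≤ Real.cos (Real.pi * s) + Real.cos (Real.pi * t) := by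
  have hhalf {x : ℝ} (hx : |x| ≤ 1 / 2) : √2 / 2 ≤ Real.cos (Real.pi * (x / 2)) := by
    have hx' : |x / 2| ≤ 1 / 4 := by
      rw [abs_div, abs_two]
      linarith
    have := cos_pi_mul_le_of_abs_le hx' (by norm_num)
    rwa [mul_one_div, Real.cos_pi_div_four] at this
  have hmul := mul_le_mul (hhalf h₁) (hhalf h₂) (by positivity)
    ((by positivity : 0 ≤ √2 / 2).trans (hhalf h₁))
  rw [Real.cos_add_cos, ← mul_add, ← mul_sub, mul_div_assoc, mul_div_assoc]
  linarith [Real.mul_self_sqrt (zero_le_two (α := ℝ))]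

lemma cos_add_two_mul_cos_three_mul_nonneg {q φ : ℝ} (hq₀ : 0 ≤ q) (hq : q ≤ 1 / 6)
    (hφ : 0 ≤ Real.cos φ) : 0 ≤ Real.cos φ + 2 * (q * Real.cos (3 * φ)) := by
  rw [Real.cos_three_mul]
  nlinarith [mul_nonneg hφ (show 0 ≤ 1 - 6 * q by linarith), mul_nonneg hq₀ (pow_nonneg hφ 3)]

lemma cos_estimates_of_cos_lt_half {x₁ x₂ x₃ t : ℝ} (ht : t = (x₁ + x₂ - 2 * x₃) / 4)
    (hx₁ : |x₁| ≤ 1 / 2) (hx₂ : |x₂| ≤ 1 / 2) (hx₃ : |x₃| ≤ 1 / 2)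
    (h : Real.cos (Real.pi * t) < 1 / 2) :
    0 ≤ Real.cos (Real.pi * (t - x₁)) ∧ 0 ≤ Real.cos (Real.pi * (t - x₂)) ∧
      86 / 100 ≤ Real.cos (Real.pi * (t + x₃)) := by
  have hlarge : 1 / 3 < |t| := by
    by_contra! hle
    have := cos_pi_mul_le_of_abs_le hle (by norm_num)
    rw [mul_one_div, Real.cos_pi_div_three] at this
    linarith
  rw [abs_le] at hx₁ hx₂ hx₃
  rw [lt_abs] at hlarge
  refine ⟨cos_pi_mul_nonneg_of_abs_le ?_, cos_pi_mul_nonneg_of_abs_le ?_, ?_⟩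
  · rw [abs_le]; constructor <;> rcases hlarge with h' | h' <;> linarith
  · rw [abs_le]; constructor <;> rcases hlarge with h' | h' <;> linarith
  · have hsixth : |t + x₃| ≤ 1 / 6 := by
      rw [abs_le]; constructor <;> rcases hlarge with h' | h' <;> linarith
    have hcos := cos_pi_mul_le_of_abs_le hsixth (by norm_num)
    rw [mul_one_div, Real.cos_pi_div_six] at hcos
    have h3 : (1.73 : ℝ) ≤ √3 := Real.le_sqrt_of_sq_le (by norm_num)
    norm_num at h3
    linarith

end Cosine

section ComplexPlane

/-- The open sector of complex numbers with argument in `(-π/4, π/4)`. -/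
def InSector (z : ℂ) : Prop := |z.im| < z.re

lemma InSector.re_mul_conj_pos {z w : ℂ} (hz : InSector z) (hw : InSector w) :
    0 < (z * conj w).re := by
  obtain ⟨h1, h2⟩ := abs_lt.1 hz
  obtain ⟨h3, h4⟩ := abs_lt.1 hw
  simp only [Complex.mul_re, Complex.conj_re, Complex.conj_im]
  nlinarith [mul_pos (sub_pos.2 h2) (sub_pos.2 h4), mul_pos (sub_pos.2 h1) (sub_pos.2 h3)]

lemma InSector.ofReal_mul {z : ℂ} (h : InSector z) {c : ℝ} (hc : 0 < c) : InSector (c * z) := by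
  unfold InSector at *
  rw [Complex.re_ofReal_mul, Complex.im_ofReal_mul, abs_mul, abs_of_pos hc]
  exact mul_lt_mul_of_pos_left h hc

lemma inSector_of_norm_sub_one_le {z : ℂ} (h : ‖z - 1‖ ≤ 41 / 100) : InSector z := by
  have him := (Complex.abs_im_le_norm (z - 1)).trans h
  have hre := (abs_le.1 ((Complex.abs_re_le_norm (z - 1)).trans h)).1
  simp only [Complex.sub_im, Complex.sub_re, Complex.one_im, Complex.one_re, sub_zero] at him hre
  unfold InSector
  linarith

lemma re_exp_pi_mul_mul_pos {t : ℝ} {ζ : ℂ} (ht : |t| ≤ 3 / 8) (hζ : ‖ζ‖ ≤ 38 / 100) :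
    0 < (cexp ((Real.pi * t : ℝ) * I) * (1 + ζ)).re := by
  have hcos := lt_cos_pi_mul_of_abs_le ht
  have hre := (abs_le.1 (Complex.abs_re_le_norm (cexp ((Real.pi * t : ℝ) * I) * ζ))).1
  rw [norm_mul, Complex.norm_exp_ofReal_mul_I, one_mul] at hre
  rw [mul_add, mul_one, Complex.add_re, Complex.exp_ofReal_mul_I_re]
  linarith

lemma inSector_iff_forall_re_pos {z : ℂ} :
    InSector z ↔ 0 < (cexp ((Real.pi * (1 / 4) : ℝ) * I) * z).re ∧
      0 < (cexp ((Real.pi * (-1 / 4) : ℝ) * I) * z).re := by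
  have hc : 0 < √2 / 2 := by positivity
  rw [Complex.mul_re, Complex.mul_re]
  simp only [Complex.exp_ofReal_mul_I_re, Complex.exp_ofReal_mul_I_im, neg_div, mul_neg,
    mul_one_div, Real.cos_neg, Real.sin_neg, Real.cos_pi_div_four, Real.sin_pi_div_four,
    ← mul_sub, mul_pos_iff_of_pos_left hc, neg_mul, sub_neg_eq_add, ← mul_add]
  rw [InSector, abs_lt, and_comm, sub_pos, neg_lt_iff_pos_add']

lemma inSector_exp_pi_mul_mul {t : ℝ} {ζ : ℂ} (ht : |t| ≤ 1 / 8) (hζ : ‖ζ‖ ≤ 38 / 100) :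
    InSector (cexp ((Real.pi * t : ℝ) * I) * (1 + ζ)) := by
  obtain ⟨h1, h2⟩ := abs_le.1 ht
  have hpos {s : ℝ} (hs : |s + t| ≤ 3 / 8) :
      0 < (cexp ((Real.pi * s : ℝ) * I) * (cexp ((Real.pi * t : ℝ) * I) * (1 + ζ))).re := by
    rw [← mul_assoc, ← Complex.exp_add, ← add_mul, ← Complex.ofReal_add, ← mul_add]
    exact re_exp_pi_mul_mul_pos hs hζ
  rw [inSector_iff_forall_re_pos]
  constructor <;> apply hpos <;> rw [abs_le] <;> constructor <;> linarith

lemma re_mul_conj_comm (z w : ℂ) : (z * conj w).re = (w * conj z).re := by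
  simp only [Complex.mul_re, Complex.conj_re, Complex.conj_im]
  ring

lemma le_re_mul_conj {u w ε η : ℂ} (hu : ‖u‖ = 1) :
    (u * conj (1 + η)).re + (u * w).re - ‖w‖ * ‖η‖ - ‖ε‖ * (1 + ‖η‖) ≤
      (u * (1 + w + ε) * conj (1 + η)).re := by
  have hexp : u * (1 + w + ε) * conj (1 + η) =
      u * conj (1 + η) + u * w + u * w * conj η + u * ε * conj (1 + η) := by
    rw [map_add, map_one]
    ring
  have h₁ := (abs_le.1 (Complex.abs_re_le_norm (u * w * conj η))).1
  have h₂ := (abs_le.1 (Complex.abs_re_le_norm (u * ε * conj (1 + η)))).1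
  rw [norm_mul, norm_mul, hu, one_mul, Complex.norm_conj] at h₁ h₂
  have h₃ : ‖1 + η‖ ≤ 1 + ‖η‖ := by simpa using norm_add_le (1 : ℂ) η
  have h₄ := mul_le_mul_of_nonneg_left h₃ (norm_nonneg ε)
  rw [hexp, Complex.add_re, Complex.add_re, Complex.add_re]
  linarith

lemma re_exp_mul_exp (α β c : ℝ) :
    (cexp (α * I) * ((c : ℂ) * cexp (β * I))).re = c * Real.cos (α + β) := by
  rw [mul_left_comm, ← Complex.exp_add, ← add_mul, ← Complex.ofReal_add, Complex.re_ofReal_mul,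
    Complex.exp_ofReal_mul_I_re]

lemma conj_exp_mul_I (α : ℝ) : conj (cexp (α * I)) = cexp ((-α : ℝ) * I) := by
  rw [← Complex.exp_conj, map_mul, Complex.conj_ofReal, Complex.conj_I, Complex.ofReal_neg,
    mul_neg, neg_mul]

lemma re_exp_mul_mul_conj_pos {φ β κ r : ℝ} {ε η : ℂ} (hr₀ : 0 ≤ r) (hr₁ : r ≤ 1)
    (hκ : κ ≤ Real.cos φ) (hsum : 1 ≤ Real.cos φ + Real.cos (φ + β))
    (hlt : (1 + r) * ‖η‖ + ‖ε‖ * (1 + ‖η‖) < κ * (1 - r) + r) :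
    0 < (cexp (φ * I) * (1 + r * cexp (β * I) + ε) * conj (1 + η)).re := by
  refine lt_of_lt_of_le ?_ (le_re_mul_conj (Complex.norm_exp_ofReal_mul_I φ))
  have hη := (abs_le.1 (Complex.abs_re_le_norm (cexp (φ * I) * conj η))).1
  rw [norm_mul, Complex.norm_exp_ofReal_mul_I, one_mul, Complex.norm_conj] at hη
  rw [map_add, map_one, mul_add, mul_one, Complex.add_re, Complex.exp_ofReal_mul_I_re,
    re_exp_mul_exp, norm_mul, Complex.norm_exp_ofReal_mul_I, mul_one, Complex.norm_real,
    Real.norm_of_nonneg hr₀]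
  nlinarith [mul_nonneg (sub_nonneg.2 hr₁) (sub_nonneg.2 hκ), mul_nonneg hr₀ (sub_nonneg.2 hsum)]

end ComplexPlane

section AcuteAngles

variable {y : ℝ} {τ : Matrix (Fin 2) (Fin 2) ℂ}

lemma re_leadForm (a₁ a₂ : ℤ) (τ : Matrix (Fin 2) (Fin 2) ℂ) :
    (leadForm a₁ a₂ τ).re =
      (a₁ * (τ 0 0).re + a₂ * (τ 1 1).re - 2 * (a₁ * a₂) * (τ 0 1).re) / 4 := by
  have h : leadForm a₁ a₂ τ = ((1 / 4 : ℝ) : ℂ) * ((a₁ : ℝ) * τ 0 0 + (a₂ : ℝ) * τ 1 1 -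
      ((2 * (a₁ * a₂) : ℝ) : ℂ) * τ 0 1) := by
    rw [leadForm]
    push_cast
    ring
  rw [h]
  simp only [Complex.add_re, Complex.sub_re, Complex.re_ofReal_mul]
  ring

lemma IsMinkowskiReduced.exp_neg_pi_mul_im_le_one (h : IsMinkowskiReduced y τ) :
    Real.exp (-Real.pi * (τ 0 1).im) ≤ 1 := by
  rw [Real.exp_le_one_iff, neg_mul, neg_nonpos]
  exact mul_nonneg Real.pi_pos.le h.nonneg

lemma IsMinkowskiReduced.nome_le_exp_neg_pi_mul_im (h : IsMinkowskiReduced y τ) :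
    nome y ≤ Real.exp (-Real.pi * (τ 0 1).im) := by
  rw [nome, Real.exp_le_exp]
  nlinarith [Real.pi_pos, h.two_mul_le]

lemma IsMinkowskiReduced.nome_pow_succ_le (h : IsMinkowskiReduced y τ) (n : ℕ) :
    nome y ^ (n + 1) ≤ (257 / 1000) ^ n * Real.exp (-Real.pi * (τ 0 1).im) := by
  have := nome_pos y
  rw [pow_succ]
  gcongr
  · exact nome_le h.sqrt_three_le
  · exact h.nome_le_exp_neg_pi_mul_im

lemma IsMinkowskiReduced.exp_neg_pi_mul_im_le_one_div_six (h : IsMinkowskiReduced y τ) :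
    Real.exp (-Real.pi * (τ 0 0 + τ 1 1 - 2 * τ 0 1).im) ≤ 1 / 6 := by
  have him : y ≤ (τ 0 0 + τ 1 1 - 2 * τ 0 1).im := by
    have : (τ 0 0 + τ 1 1 - 2 * τ 0 1).im = (τ 0 0).im + (τ 1 1).im - 2 * (τ 0 1).im := by simp
    linarith [h.le_zero_zero, h.le_one_one, h.two_mul_le]
  calc Real.exp (-Real.pi * (τ 0 0 + τ 1 1 - 2 * τ 0 1).im)
      ≤ Real.exp (-Real.pi * y) := Real.exp_le_exp.2 (by nlinarith [Real.pi_pos])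
    _ = nome y ^ 2 := by rw [nome, ← Real.exp_nat_mul]; congr 1; push_cast; ring
    _ ≤ (257 / 1000) ^ 2 := pow_le_pow_left₀ (nome_pos y).le (nome_le h.sqrt_three_le) 2
    _ ≤ 1 / 6 := by norm_num

lemma inSector_thetaSeries_zero_zero (h : IsMinkowskiReduced y τ) (b₁ b₂ : ℤ) :
    InSector (thetaSeries ![0, 0] ![b₁, b₂] τ) :=
  inSector_of_norm_sub_one_le (norm_thetaSeries_zero_zero_sub_one_le h b₁ b₂)

lemma inSector_thetaSeries_one_zero (h : IsMinkowskiReduced y τ) (hx : |(τ 0 0).re| ≤ 1 / 2)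
    (b₂ : ℤ) : InSector (thetaSeries ![1, 0] ![0, b₂] τ) := by
  obtain ⟨c, hc, η, hη, heq⟩ := exists_thetaSeries_one_zero_eq h b₂
  rw [heq]
  refine (inSector_exp_pi_mul_mul ?_ ?_).ofReal_mul hc
  · simp only [re_leadForm, Int.cast_one, Int.cast_zero, one_mul, zero_mul, mul_zero, add_zero,
      sub_zero, abs_div, Nat.abs_ofNat]
    linarith
  · linarith [nome_le h.sqrt_three_le]

lemma inSector_thetaSeries_zero_one (h : IsMinkowskiReduced y τ) (hx : |(τ 1 1).re| ≤ 1 / 2)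
    (b₁ : ℤ) : InSector (thetaSeries ![0, 1] ![b₁, 0] τ) := by
  have := inSector_thetaSeries_one_zero h.swapVars hx b₁
  rwa [thetaSeries_swapVars] at this

lemma re_thetaSeries_one_one_mul_conj_one_zero_pos (h : IsMinkowskiReduced y τ)
    (hx₂ : |(τ 1 1).re| ≤ 1 / 2) (hx₃ : |(τ 0 1).re| ≤ 1 / 2) :
    0 < (thetaSeries ![1, 1] ![0, 0] τ * conj (thetaSeries ![1, 0] ![0, 0] τ)).re := by
  obtain ⟨c, hc, ε, hε, h₁₁⟩ := exists_thetaSeries_one_one_eq h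
  obtain ⟨d, hd, η, hη, h₁₀⟩ := exists_thetaSeries_one_zero_eq h 0
  set s := ((τ 1 1).re - 2 * (τ 0 1).re) / 4 with hs
  have hphase : Real.pi * (leadForm 1 1 τ).re + -(Real.pi * (leadForm 1 0 τ).re) =
      Real.pi * s := by
    simp only [re_leadForm, hs, Int.cast_one, Int.cast_zero]
    ring
  have heq : thetaSeries ![1, 1] ![0, 0] τ * conj (thetaSeries ![1, 0] ![0, 0] τ) =
      (c * d : ℝ) * (cexp ((Real.pi * s : ℝ) * I) *
        (1 + cexp (Real.pi * I * τ 0 1) + ε) * conj (1 + η)) := by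
    rw [h₁₁, h₁₀, map_mul, map_mul, Complex.conj_ofReal, conj_exp_mul_I, ← hphase,
      Complex.ofReal_add, add_mul, Complex.exp_add]
    push_cast
    ring
  rw [heq, Complex.re_ofReal_mul, cexp_pi_mul_I_mul_eq]
  rw [abs_le] at hx₂ hx₃
  refine mul_pos (mul_pos hc hd) (re_exp_mul_mul_conj_pos (κ := 381 / 1000) (Real.exp_pos _).le
    h.exp_neg_pi_mul_im_le_one (lt_cos_pi_mul_of_abs_le ?_).le ?_ ?_)
  · rw [abs_le]; constructor <;> linarith
  · rw [← mul_add]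
    apply one_le_cos_add_cos <;> rw [abs_le] <;> constructor <;> linarith
  · have hp := nome_le h.sqrt_three_le
    have hp3 := h.nome_pow_succ_le 2
    have hε' : ‖ε‖ * (1 + ‖η‖) ≤ 57 / 20 * nome y ^ 3 * (135 / 100) :=
      mul_le_mul hε (by linarith) (by positivity) (by have := nome_pos y; positivity)
    have hη' := mul_le_mul_of_nonneg_left (hη.trans (mul_le_mul_of_nonneg_left hp (by norm_num)))
      (by positivity : 0 ≤ 1 + Real.exp (-Real.pi * (τ 0 1).im))
    linarith [Real.exp_pos (-Real.pi * (τ 0 1).im), h.exp_neg_pi_mul_im_le_one]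

lemma re_thetaSeries_one_one_mul_conj_zero_one_pos (h : IsMinkowskiReduced y τ)
    (hx₁ : |(τ 0 0).re| ≤ 1 / 2) (hx₃ : |(τ 0 1).re| ≤ 1 / 2) :
    0 < (thetaSeries ![1, 1] ![0, 0] τ * conj (thetaSeries ![0, 1] ![0, 0] τ)).re := by
  have hx₃' : |(swapVars τ 0 1).re| ≤ 1 / 2 := by
    rwa [← isSymm_fin_two_iff.1 h.isSymm] at hx₃
  have := re_thetaSeries_one_one_mul_conj_one_zero_pos h.swapVars hx₁ hx₃'
  rwa [thetaSeries_swapVars, thetaSeries_swapVars] at this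

lemma neg_le_re_exp_mul_conj_thetaSeries (h : IsMinkowskiReduced y τ) {t : ℝ}
    (ht : t = ((τ 0 0).re + (τ 1 1).re - 2 * (τ 0 1).re) / 4) (ht₀ : 0 ≤ Real.cos (Real.pi * t))
    (ht₁ : 0 ≤ Real.cos (Real.pi * (t - (τ 0 0).re)))
    (ht₂ : 0 ≤ Real.cos (Real.pi * (t - (τ 1 1).re))) :
    -(nome y ^ 4 * (26 / 10)) ≤
      (cexp ((Real.pi * t : ℝ) * I) * conj (thetaSeries ![0, 0] ![0, 0] τ)).re := by
  obtain ⟨ρ, hρ, heq⟩ := exists_thetaSeries_zero_zero_eq h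
  have hre (z : ℂ) : (cexp ((Real.pi * t : ℝ) * I) * conj (cexp (Real.pi * I * z))).re =
      Real.exp (-Real.pi * z.im) * Real.cos (Real.pi * (t - z.re)) := by
    rw [cexp_pi_mul_I_mul_eq, map_mul, Complex.conj_ofReal, conj_exp_mul_I, re_exp_mul_exp, mul_sub,
      sub_eq_add_neg]
  have htwo (z : ℂ) : (2 * z).re = 2 * z.re := by exact_mod_cast Complex.re_ofReal_mul 2 z
  have hthree : Real.cos (Real.pi * (t - (τ 0 0 + τ 1 1 - 2 * τ 0 1).re)) =
      Real.cos (3 * (Real.pi * t)) := by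
    have hre₃ : (τ 0 0 + τ 1 1 - 2 * τ 0 1).re = 4 * t := by simp [ht]; ring
    rw [hre₃, ← Real.cos_neg]
    congr 1
    ring
  have hq := cos_add_two_mul_cos_three_mul_nonneg (Real.exp_pos _).le
    h.exp_neg_pi_mul_im_le_one_div_six ht₀
  have hρ' := (abs_le.1 (Complex.abs_re_le_norm (cexp ((Real.pi * t : ℝ) * I) * conj ρ))).1
  rw [norm_mul, Complex.norm_exp_ofReal_mul_I, one_mul, Complex.norm_conj] at hρ'
  rw [heq]
  simp only [map_add, map_mul, map_one, map_ofNat, mul_add, mul_one, Complex.add_re,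
    mul_left_comm _ (2 : ℂ), htwo, hre, hthree, Complex.exp_ofReal_mul_I_re]
  linarith [mul_nonneg (Real.exp_pos (-Real.pi * (τ 0 0).im)).le ht₁,
    mul_nonneg (Real.exp_pos (-Real.pi * (τ 1 1).im)).le ht₂]

lemma re_exp_mul_mul_conj_thetaSeries_pos (h : IsMinkowskiReduced y τ)
    (hx₁ : |(τ 0 0).re| ≤ 1 / 2) (hx₂ : |(τ 1 1).re| ≤ 1 / 2) (hx₃ : |(τ 0 1).re| ≤ 1 / 2)
    {t : ℝ} (ht : t = ((τ 0 0).re + (τ 1 1).re - 2 * (τ 0 1).re) / 4) {ε : ℂ}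
    (hε : ‖ε‖ ≤ 57 / 20 * nome y ^ 3) :
    0 < (cexp ((Real.pi * t : ℝ) * I) * (1 + cexp (Real.pi * I * τ 0 1) + ε) *
      conj (thetaSeries ![0, 0] ![0, 0] τ)).re := by
  have hη := norm_thetaSeries_zero_zero_sub_one_le h 0 0
  have hθ := add_sub_cancel 1 (thetaSeries ![0, 0] ![0, 0] τ)
  set η := thetaSeries ![0, 0] ![0, 0] τ - 1
  have hp₃ := h.nome_pow_succ_le 2
  have hp₄ := h.nome_pow_succ_le 3
  set r := Real.exp (-Real.pi * (τ 0 1).im) with hr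
  have hr₀ : 0 < r := Real.exp_pos _
  have hr₁ : r ≤ 1 := h.exp_neg_pi_mul_im_le_one
  have hε' : ‖ε‖ * (1 + ‖η‖) ≤ 57 / 20 * nome y ^ 3 * (141 / 100) :=
    mul_le_mul hε (by linarith) (by positivity) (by have := nome_pos y; positivity)
  have hx₁' := abs_le.1 hx₁
  have hx₂' := abs_le.1 hx₂
  have hx₃' := abs_le.1 hx₃
  by_cases hcos : 1 / 2 ≤ Real.cos (Real.pi * t)
  · rw [← hθ, cexp_pi_mul_I_mul_eq, ← hr]
    refine re_exp_mul_mul_conj_pos hr₀.le hr₁ hcos ?_ ?_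
    · rw [← mul_add]
      apply one_le_cos_add_cos <;> rw [abs_le] <;> constructor <;> linarith
    · have hη' := mul_le_mul_of_nonneg_left hη (by positivity : 0 ≤ 1 + r)
      linarith [pow_le_pow_left₀ (nome_pos y).le (nome_le h.sqrt_three_le) 3]
  · have ht₀ : 0 ≤ Real.cos (Real.pi * t) := by
      apply cos_pi_mul_nonneg_of_abs_le
      rw [abs_le]; constructor <;> linarith
    obtain ⟨ht₁, ht₂, ht₃⟩ := cos_estimates_of_cos_lt_half ht hx₁ hx₂ hx₃ (not_le.1 hcos)
    have hmain := neg_le_re_exp_mul_conj_thetaSeries h ht ht₀ ht₁ ht₂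
    rw [← hθ] at hmain ⊢
    refine lt_of_lt_of_le ?_ (le_re_mul_conj (Complex.norm_exp_ofReal_mul_I _))
    rw [norm_cexp_pi_mul_I_mul, ← hr, cexp_pi_mul_I_mul_eq, re_exp_mul_exp, ← mul_add, ← hr]
    have hη' := mul_le_mul_of_nonneg_left hη hr₀.le
    have hψ := mul_le_mul_of_nonneg_left ht₃ hr₀.le
    linarith

lemma re_thetaSeries_one_one_mul_conj_zero_zero_pos (h : IsMinkowskiReduced y τ)
    (hx₁ : |(τ 0 0).re| ≤ 1 / 2) (hx₂ : |(τ 1 1).re| ≤ 1 / 2) (hx₃ : |(τ 0 1).re| ≤ 1 / 2) :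
    0 < (thetaSeries ![1, 1] ![0, 0] τ * conj (thetaSeries ![0, 0] ![0, 0] τ)).re := by
  obtain ⟨c, hc, ε, hε, heq⟩ := exists_thetaSeries_one_one_eq h
  rw [heq, mul_assoc, Complex.re_ofReal_mul]
  refine mul_pos hc (re_exp_mul_mul_conj_thetaSeries_pos h hx₁ hx₂ hx₃ ?_ hε)
  simp only [re_leadForm, Int.cast_one, one_mul, mul_one]

end AcuteAngles

section GoodPosition

variable {ι : Type*} {s : ι → ℂ}

/-- A family of complex numbers any two members of which, equal or not, enclose an acute angle.
Unlike good position, this is a condition on pairs, hence accessible to continuity arguments. -/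
def PairwiseAcute (s : ι → ℂ) : Prop := ∀ i j, 0 < (s i * conj (s j)).re

lemma re_const_mul_mul_conj (u z w : ℂ) :
    (u * z * conj (u * w)).re = normSq u * (z * conj w).re := by
  rw [← Complex.re_ofReal_mul, ← Complex.mul_conj, map_mul, mul_mul_mul_comm]

lemma PairwiseAcute.const_mul (h : PairwiseAcute s) {c : ℂ} (hc : c ≠ 0) :
    PairwiseAcute fun i => c * s i := fun i j => by
  rw [re_const_mul_mul_conj]
  exact mul_pos (normSq_pos.2 hc) (h i j)

lemma pairwiseAcute_of_inSector (h : ∀ i, InSector (s i)) : PairwiseAcute s :=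
  fun i j => (h i).re_mul_conj_pos (h j)

lemma pairwiseAcute_of_inSector_of_ne {i₀ : ι} (h₀ : s i₀ ≠ 0)
    (h : ∀ i ≠ i₀, InSector (s i) ∧ 0 < (s i₀ * conj (s i)).re) : PairwiseAcute s := by
  intro i j
  rcases eq_or_ne i i₀ with rfl | hi <;> rcases eq_or_ne j i with rfl | hj
  · rw [Complex.mul_conj, Complex.ofReal_re]
    exact normSq_pos.2 h₀
  · exact (h j hj).2
  · exact (h j hi).1.re_mul_conj_pos (h j hi).1
  · rcases eq_or_ne j i₀ with rfl | hj'
    · rw [re_mul_conj_comm]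
      exact (h i hi).2
    · exact (h i hi).1.re_mul_conj_pos (h j hj').1

lemma PairwiseAcute.exists_forall_im_nonneg [Finite ι] [Nonempty ι] (h : PairwiseAcute s) :
    ∃ k, ∀ i, 0 ≤ (s i * conj (s k)).im := by
  obtain ⟨i₀⟩ := ‹Nonempty ι›
  obtain ⟨k, hk⟩ := Finite.exists_min fun i => (s i * conj (s i₀)).im / (s i * conj (s i₀)).re
  refine ⟨k, fun i => ?_⟩
  have hle := hk i
  rw [div_le_div_iff₀ (h k i₀) (h i i₀)] at hle
  have hdet : (s i * conj (s i₀)).im * (s k * conj (s i₀)).re -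
      (s k * conj (s i₀)).im * (s i * conj (s i₀)).re =
      (s i * conj (s k)).im * (s i₀ * conj (s i₀)).re := by
    simp only [Complex.mul_re, Complex.mul_im, Complex.conj_re, Complex.conj_im]
    ring
  exact nonneg_of_mul_nonneg_left (by linarith) (h i₀ i₀)

theorem PairwiseAcute.inGoodPosition [Finite ι] [Nonempty ι] (h : PairwiseAcute s) :
    InGoodPosition (Set.range s) := by
  obtain ⟨k, him⟩ := h.exists_forall_im_nonneg
  have hsmall : ∀ᶠ δ : ℝ in 𝓝[>] 0, ∀ i, 0 < (s i * conj (s k)).re - δ * (s i * conj (s k)).im := by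
    refine Filter.Eventually.filter_mono nhdsWithin_le_nhds (Filter.eventually_all.2 fun i => ?_)
    have hcont : Continuous fun δ : ℝ => (s i * conj (s k)).re - δ * (s i * conj (s k)).im := by
      fun_prop
    exact hcont.continuousAt.eventually_const_lt (by simpa using h i k)
  obtain ⟨δ, hδ, hpos : 0 < δ⟩ := (hsmall.and self_mem_nhdsWithin).exists
  have hk : s k ≠ 0 := fun h0 => by simpa [h0] using h k k
  have hδ₀ : (1 + δ * I : ℂ) ≠ 0 := fun h0 => by simpa using congrArg Complex.re h0
  refine ⟨(1 + δ * I) * conj (s k), mul_ne_zero hδ₀ (star_ne_zero.2 hk), ?_⟩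
  rintro _ ⟨i, rfl⟩
  have hrot : (1 + δ * I) * conj (s k) * s i =
      s i * conj (s k) + δ * (I * (s i * conj (s k))) := by ring
  rw [hrot, Complex.add_re, Complex.add_im, Complex.re_ofReal_mul, Complex.im_ofReal_mul,
    Complex.I_mul_re, Complex.I_mul_im, mul_neg, ← sub_eq_add_neg]
  exact ⟨hδ i, add_pos_of_nonneg_of_pos (him i) (mul_pos hpos (h i k))⟩

-- Such `z` and `w` lie in the union of the first and the third open quadrant.
lemma re_mul_conj_ne_zero_of_im_sq_pos {z w : ℂ} (hz : 0 < (z ^ 2).im) (hw : 0 < (w ^ 2).im) :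
    (z * conj w).re ≠ 0 := by
  intro h0
  rw [pow_two, Complex.mul_im] at hz hw
  rw [Complex.mul_re, Complex.conj_re, Complex.conj_im] at h0
  have hprod : 0 < (z.re * z.im) * (w.re * w.im) := mul_pos (by linarith) (by linarith)
  have hneg : (z.re * z.im) * (w.re * w.im) = -(z.im * w.im) ^ 2 := by
    linear_combination (z.im * w.im) * h0
  linarith [sq_nonneg (z.im * w.im)]

theorem re_mul_conj_ne_zero_of_inGoodPosition {G : Type*} [AddGroup G] [Fintype G]
    [DecidableEq G] {s t : G → ℂ} (ht : InGoodPosition (Set.range t)) {r : ℝ} (hr : 0 < r)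
    (hs : ∀ b, s b ^ 2 = r * ∑ p : G × G with p.1 + p.2 = b, t p.1 * t p.2) (b c : G) :
    (s b * conj (s c)).re ≠ 0 := by
  obtain ⟨u, -, hut⟩ := ht
  have him (b : G) : 0 < ((u * s b) ^ 2).im := by
    have hsq : (u * s b) ^ 2 =
        r * ∑ p : G × G with p.1 + p.2 = b, (u * t p.1) * (u * t p.2) := by
      simp only [mul_pow, hs, mul_mul_mul_comm u, ← pow_two, ← Finset.mul_sum]
      ring
    rw [hsq, Complex.im_ofReal_mul, Complex.im_sum]
    refine mul_pos hr (Finset.sum_pos (fun p _ => ?_) ⟨(b, 0), by simp⟩)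
    obtain ⟨h₁, h₂⟩ := hut _ ⟨p.1, rfl⟩
    obtain ⟨h₃, h₄⟩ := hut _ ⟨p.2, rfl⟩
    rw [Complex.mul_im]
    positivity
  have hne := re_mul_conj_ne_zero_of_im_sq_pos (him b) (him c)
  rw [re_const_mul_mul_conj] at hne
  exact right_ne_zero_of_mul hne

lemma PairwiseAcute.of_isPreconnected {X : Type*} [TopologicalSpace X] {K : Set X}
    (hK : IsPreconnected K) {s : X → ι → ℂ} (hs : ∀ i, ContinuousOn (fun x => s x i) K)
    (hne : ∀ x ∈ K, ∀ i j, (s x i * conj (s x j)).re ≠ 0) {x₀ x : X} (hx₀ : x₀ ∈ K)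
    (h₀ : PairwiseAcute (s x₀)) (hx : x ∈ K) : PairwiseAcute (s x) := by
  intro i j
  have hcont : ContinuousOn (fun x => (s x i * conj (s x j)).re) K :=
    Complex.continuous_re.comp_continuousOn
      ((hs i).mul (Complex.continuous_conj.comp_continuousOn (hs j)))
  by_contra! hle
  obtain ⟨y, hy, hy₀⟩ := hK.intermediate_value hx hx₀ hcont ⟨hle, (h₀ i j).le⟩
  exact hne y hy i j hy₀

end GoodPosition

section Domain

variable {τ : Matrix (Fin 2) (Fin 2) ℂ}

/-- A convex set containing `FPrime`, on which the theta constants are studied: compared with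
`FPrime`, the conditions `1 ≤ |z₁|` and `1 ≤ |z₂|` are dropped, and those on the imaginary part are
made symmetric in the two variables. -/
def minkowskiDomain : Set (Matrix (Fin 2) (Fin 2) ℂ) :=
  {τ | τ.IsSymm ∧
    |(τ 0 0).re| ≤ 1 / 2 ∧ |(τ 1 1).re| ≤ 1 / 2 ∧ |(τ 0 1).re| ≤ 1 / 2 ∧
    √3 / 2 ≤ (τ 0 0).im ∧ √3 / 2 ≤ (τ 1 1).im ∧
    2 * |(τ 0 1).im| ≤ (τ 0 0).im ∧ 2 * |(τ 0 1).im| ≤ (τ 1 1).im}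

lemma FPrime_subset_minkowskiDomain : FPrime ⊆ minkowskiDomain :=
  fun _ ⟨hτ, hx₁, hx₂, hx₃, hy₃, hy₂, hy₁, _, _⟩ =>
    ⟨hτ.1, hx₁, hx₂, hx₃, hy₁, hy₁.trans hy₂, hy₃, hy₃.trans hy₂⟩

lemma minkowskiDomain_subset_siegelH2 : minkowskiDomain ⊆ SiegelH2 := by
  rintro τ ⟨hsymm, -, -, -, hy₁, hy₂, hy₃, hy₃'⟩
  have hsqrt : 0 < √3 / 2 := by positivity
  refine mem_siegelH2_iff.2 ⟨hsymm, hsqrt.trans_le hy₁, ?_⟩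
  rw [← sq_abs]
  nlinarith [abs_nonneg (τ 0 1).im, mul_le_mul hy₃ hy₃' (by positivity) (hsqrt.le.trans hy₁)]

theorem convex_minkowskiDomain : Convex ℝ minkowskiDomain := by
  rintro σ ⟨hσ, hσx₁, hσx₂, hσx₃, hσy₁, hσy₂, hσy₃, hσy₃'⟩
    τ ⟨hτ, hτx₁, hτx₂, hτx₃, hτy₁, hτy₂, hτy₃, hτy₃'⟩ s t hs ht hst
  have hentry (i j : Fin 2) : (s • σ + t • τ) i j = s * σ i j + t * τ i j := by simp
  have hre (z w : ℂ) : (s * z + t * w).re = s * z.re + t * w.re := by simp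
  have him (z w : ℂ) : (s * z + t * w).im = s * z.im + t * w.im := by simp
  have habs (u v : ℝ) : |s * u + t * v| ≤ s * |u| + t * |v| := by
    simpa only [abs_mul, abs_of_nonneg hs, abs_of_nonneg ht] using abs_add_le (s * u) (t * v)
  refine ⟨(hσ.smul s).add (hτ.smul t), ?_⟩
  simp only [hentry, hre, him]
  refine ⟨(habs _ _).trans ?_, (habs _ _).trans ?_, (habs _ _).trans ?_, ?_, ?_, ?_, ?_⟩
  · exact convex_Iic (𝕜 := ℝ) (1 / 2 : ℝ) (Set.mem_Iic.2 hσx₁) (Set.mem_Iic.2 hτx₁) hs ht hst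
  · exact convex_Iic (𝕜 := ℝ) (1 / 2 : ℝ) (Set.mem_Iic.2 hσx₂) (Set.mem_Iic.2 hτx₂) hs ht hst
  · exact convex_Iic (𝕜 := ℝ) (1 / 2 : ℝ) (Set.mem_Iic.2 hσx₃) (Set.mem_Iic.2 hτx₃) hs ht hst
  · exact convex_Ici (𝕜 := ℝ) (√3 / 2) (Set.mem_Ici.2 hσy₁) (Set.mem_Ici.2 hτy₁) hs ht hst
  · exact convex_Ici (𝕜 := ℝ) (√3 / 2) (Set.mem_Ici.2 hσy₂) (Set.mem_Ici.2 hτy₂) hs ht hst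
  · nlinarith [habs (σ 0 1).im (τ 0 1).im]
  · nlinarith [habs (σ 0 1).im (τ 0 1).im]

end Domain

section LevelZero

variable {τ : Matrix (Fin 2) (Fin 2) ℂ}

lemma zmodLift_fin_two (b : Fin 2 → ZMod 2) :
    zmodLift b = ![((b 0).val : ℤ), ((b 1).val : ℤ)] := by
  ext i
  fin_cases i <;> rfl

lemma theta_zero_eq_thetaSeries (b : Fin 2 → ZMod 2) (τ : Matrix (Fin 2) (Fin 2) ℂ) :
    theta 0 b τ = thetaSeries 0 ![(b 0).val, (b 1).val] τ := by
  rw [theta_eq_thetaSeries, zmodLift_zero, zmodLift_fin_two]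

lemma pairwiseAcute_theta_of_isMinkowskiReduced {y : ℝ} (h : IsMinkowskiReduced y τ) :
    PairwiseAcute fun b => theta 0 b τ :=
  pairwiseAcute_of_inSector fun b => by
    rw [theta_zero_eq_thetaSeries, zero_eq_vec]
    exact inSector_thetaSeries_zero_zero h _ _

lemma exists_isMinkowskiReduced_of_mem_minkowskiDomain (h : τ ∈ minkowskiDomain) :
    ∃ y σ, IsMinkowskiReduced y σ ∧ |(σ 0 0).re| ≤ 1 / 2 ∧ |(σ 1 1).re| ≤ 1 / 2 ∧
      |(σ 0 1).re| ≤ 1 / 2 ∧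
      ∀ a b : Fin 2 → ℤ, a 1 * b 1 = 0 → thetaSeries a b σ = thetaSeries a b τ := by
  have hτ := minkowskiDomain_subset_siegelH2 h
  obtain ⟨-, hx₁, hx₂, hx₃, hy₁, hy₂, hy₃, hy₃'⟩ := h
  have hy := le_min hy₁ hy₂
  have hmin := le_min hy₃ hy₃'
  rcases le_total 0 (τ 0 1).im with hnonneg | hnonpos
  · rw [abs_of_nonneg hnonneg] at hmin
    exact ⟨_, τ, ⟨hτ.1, hy, min_le_left _ _, min_le_right _ _, hnonneg, hmin⟩, hx₁, hx₂, hx₃,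
      fun _ _ _ => rfl⟩
  · rw [abs_of_nonpos hnonpos] at hmin
    have hred : IsMinkowskiReduced (min (τ 0 0).im (τ 1 1).im) (flipSign τ) :=
      ⟨(flipSign_mem_siegelH2 hτ).1, hy, min_le_left _ _, min_le_right _ _,
        neg_nonneg.2 hnonpos, hmin⟩
    exact ⟨_, flipSign τ, hred, hx₁, hx₂, by simpa [flipSign] using hx₃,
      fun _ _ hab => thetaSeries_flipSign hab τ⟩

lemma one_sub_val_eq_zero_or_one : ∀ x : ZMod 2, (1 - x.val : ℤ) = 0 ∨ (1 - x.val : ℤ) = 1 := by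
  decide

lemma pairwiseAcute_thetaSeries_zmodLift_zero (h : τ ∈ minkowskiDomain) :
    PairwiseAcute fun a : Fin 2 → ZMod 2 => thetaSeries (zmodLift a) 0 τ := by
  obtain ⟨y, σ, hσ, hx₁, hx₂, hx₃, heq⟩ := exists_isMinkowskiReduced_of_mem_minkowskiDomain h
  have h₀₀ := re_thetaSeries_one_one_mul_conj_zero_zero_pos hσ hx₁ hx₂ hx₃
  simp only [← heq _ 0 (mul_zero _)]
  refine pairwiseAcute_of_inSector_of_ne (i₀ := 1) ?_ fun a ha => ?_
  · rw [zmodLift_fin_two, zero_eq_vec]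
    exact left_ne_zero_of_mul (ne_of_apply_ne Complex.re h₀₀.ne')
  rw [zmodLift_fin_two, zmodLift_fin_two, zero_eq_vec]
  have hcases : ∀ a : Fin 2 → ZMod 2, a ≠ 1 → a = ![0, 0] ∨ a = ![1, 0] ∨ a = ![0, 1] := by
    decide
  rcases hcases a ha with rfl | rfl | rfl
  · exact ⟨inSector_thetaSeries_zero_zero hσ 0 0, h₀₀⟩
  · exact ⟨inSector_thetaSeries_one_zero hσ hx₁ 0,
      re_thetaSeries_one_one_mul_conj_one_zero_pos hσ hx₂ hx₃⟩
  · exact ⟨inSector_thetaSeries_zero_one hσ hx₂ 0,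
      re_thetaSeries_one_one_mul_conj_zero_one_pos hσ hx₁ hx₃⟩

lemma inSector_thetaSeries_of_mem_minkowskiDomain (h : τ ∈ minkowskiDomain) (b₁ b₂ : ℤ) :
    InSector (thetaSeries ![0, 0] ![b₁, b₂] τ) ∧ InSector (thetaSeries ![1, 0] ![0, b₂] τ) ∧
      InSector (thetaSeries ![0, 1] ![b₁, 0] τ) := by
  obtain ⟨y, σ, hσ, hx₁, hx₂, -, heq⟩ := exists_isMinkowskiReduced_of_mem_minkowskiDomain h
  rw [← heq _ _ (by simp), ← heq _ _ (by simp), ← heq _ _ (by simp)]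
  exact ⟨inSector_thetaSeries_zero_zero hσ b₁ b₂, inSector_thetaSeries_one_zero hσ hx₁ b₂,
    inSector_thetaSeries_zero_one hσ hx₂ b₁⟩

lemma pairwiseAcute_theta_of_eq_const_mul {c : ℂ} {f : (Fin 2 → ZMod 2) → ℂ} (hc : c ≠ 0)
    (h : ∀ b, thetaSeries 0 ![(b 0).val, (b 1).val] τ = c * f b) (hf : PairwiseAcute f) :
    PairwiseAcute fun b => theta 0 b τ := by
  simp only [theta_zero_eq_thetaSeries, h]
  exact hf.const_mul hc

theorem pairwiseAcute_theta_spAct_gamma (h : τ ∈ minkowskiDomain) (k : Fin 4) :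
    PairwiseAcute fun b => theta 0 b (spAct (gamma k) τ) := by
  match k with
  | 0 =>
    refine pairwiseAcute_of_inSector fun b => ?_
    rw [show gamma 0 = 1 from rfl, spAct_one, theta_zero_eq_thetaSeries, zero_eq_vec]
    exact (inSector_thetaSeries_of_mem_minkowskiDomain h _ _).1
  | 1 =>
    obtain ⟨c, hc, heq⟩ := exists_thetaSeries_spAct_gamma_one (minkowskiDomain_subset_siegelH2 h)
    refine pairwiseAcute_theta_of_eq_const_mul hc (fun b => heq _ _)
      (pairwiseAcute_of_inSector fun b => ?_)
    obtain ⟨h₀₀, h₁₀, -⟩ := inSector_thetaSeries_of_mem_minkowskiDomain h 0 (b 1).val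
    rcases one_sub_val_eq_zero_or_one (b 0) with h0 | h0 <;> rwa [h0]
  | 2 =>
    obtain ⟨c, hc, heq⟩ := exists_thetaSeries_spAct_gamma_two (minkowskiDomain_subset_siegelH2 h)
    refine pairwiseAcute_theta_of_eq_const_mul hc (fun b => heq _ _)
      (pairwiseAcute_of_inSector fun b => ?_)
    obtain ⟨h₀₀, -, h₀₁⟩ := inSector_thetaSeries_of_mem_minkowskiDomain h (b 0).val 0
    rcases one_sub_val_eq_zero_or_one (b 1) with h0 | h0 <;> rwa [h0]
  | 3 =>
    obtain ⟨c, hc, heq⟩ := exists_thetaSeries_spAct_gamma_three (minkowskiDomain_subset_siegelH2 h)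
    have hacute := pairwiseAcute_thetaSeries_zmodLift_zero h
    simp only [zmodLift_fin_two] at hacute
    exact pairwiseAcute_theta_of_eq_const_mul hc (fun b => heq _ _)
      fun b b' => hacute ![b 1, b 0] ![b' 1, b' 0]

end LevelZero

section BasePoint

lemma sqrt_three_div_two_le_one : √3 / 2 ≤ 1 := by
  rw [div_le_one two_pos, Real.sqrt_le_left zero_le_two]
  norm_num

/-- The base point `2i · 1`, where the imaginary part is diagonal and large enough for the angles
between the theta constants to be read off from their expansions. -/
def baseMatrix : Matrix (Fin 2) (Fin 2) ℂ := !![2 * I, 0; 0, 2 * I]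

lemma baseMatrix_mem_minkowskiDomain : baseMatrix ∈ minkowskiDomain := by
  have hle := sqrt_three_div_two_le_one.trans one_le_two
  refine ⟨isSymm_fin_two_iff.2 rfl, ?_, ?_, ?_, ?_, ?_, ?_, ?_⟩ <;> simp [baseMatrix, hle]

lemma baseMatrix_mem_siegelH2 : baseMatrix ∈ SiegelH2 :=
  minkowskiDomain_subset_siegelH2 baseMatrix_mem_minkowskiDomain

lemma im_spAct_gamma_baseMatrix (k : Fin 4) :
    1 / 2 ≤ (spAct (gamma k) baseMatrix 0 0).im ∧ 1 / 2 ≤ (spAct (gamma k) baseMatrix 1 1).im ∧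
      (spAct (gamma k) baseMatrix 0 1).im = 0 := by
  have hbase := baseMatrix_mem_siegelH2
  have hinv : -1 / (2 * I) = I / 2 := by
    rw [div_eq_div_iff (by simp) two_ne_zero]
    linear_combination -2 * I_mul_I
  match k with
  | 0 =>
    rw [show gamma 0 = 1 from rfl, spAct_one]
    norm_num [baseMatrix]
  | 1 =>
    rw [spAct_gamma_one hbase]
    norm_num [hinv, baseMatrix, partialInv]
  | 2 =>
    rw [spAct_gamma_two hbase, spAct_gamma_one (swapVars_mem_siegelH2 hbase)]
    norm_num [hinv, baseMatrix, partialInv, swapVars]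
  | 3 =>
    rw [spAct_gamma_three hbase]
    norm_num [hinv, baseMatrix, partialInv, swapVars]

lemma isMinkowskiReduced_two_pow_smul_spAct_gamma_baseMatrix (k : Fin 4) (n : ℕ) :
    IsMinkowskiReduced 1 ((2 : ℂ) ^ (n + 1) • spAct (gamma k) baseMatrix) := by
  obtain ⟨h₀₀, h₁₁, h₀₁⟩ := im_spAct_gamma_baseMatrix k
  have hpow : (2 : ℂ) ^ (n + 1) = ((2 ^ (n + 1) : ℝ) : ℂ) := by norm_cast
  have htwo : (2 : ℝ) ≤ 2 ^ (n + 1) := le_self_pow₀ one_le_two n.succ_ne_zero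
  refine ⟨(spAct_gamma_mem_siegelH2 baseMatrix_mem_siegelH2 k).1.smul _,
    sqrt_three_div_two_le_one, ?_, ?_, ?_, ?_⟩ <;>
  rw [hpow, Matrix.smul_apply, smul_eq_mul, Complex.im_ofReal_mul]
  · nlinarith
  · nlinarith
  · rw [h₀₁, mul_zero]
  · rw [h₀₁, mul_zero, mul_zero]
    exact zero_le_one

end BasePoint

section GoodSigns

variable {τ : Matrix (Fin 2) (Fin 2) ℂ}

lemma two_pow_smul_mem_siegelH2 (h : τ ∈ SiegelH2) (n : ℕ) : (2 : ℂ) ^ n • τ ∈ SiegelH2 := by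
  exact_mod_cast smul_mem_siegelH2 h (r := 2 ^ n) (by positivity)

lemma continuousOn_theta (a b : Fin 2 → ZMod 2) : ContinuousOn (theta a b) SiegelH2 := by
  rw [funext (theta_eq_thetaSeries a b)]
  exact fun τ hτ => (continuousAt_thetaSeries _ _ hτ.2).continuousWithinAt

lemma continuousOn_theta_two_pow_smul_spAct_gamma (a b : Fin 2 → ZMod 2) (k : Fin 4) (n : ℕ) :
    ContinuousOn (fun τ => theta a b ((2 : ℂ) ^ n • spAct (gamma k) τ)) SiegelH2 :=
  (continuousOn_theta a b).comp ((continuousOn_spAct_gamma k).const_smul ((2 : ℂ) ^ n))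
    fun _ hτ => two_pow_smul_mem_siegelH2 (spAct_gamma_mem_siegelH2 hτ k) n

lemma theta_zero_sq_two_pow_succ_smul (h : τ ∈ SiegelH2) (n : ℕ) (b : Fin 2 → ZMod 2) :
    theta 0 b ((2 : ℂ) ^ (n + 1) • τ) ^ 2 =
      1 / 4 * ∑ p : (Fin 2 → ZMod 2) × (Fin 2 → ZMod 2) with p.1 + p.2 = b,
        theta 0 p.1 ((2 : ℂ) ^ n • τ) * theta 0 p.2 ((2 : ℂ) ^ n • τ) := by
  rw [pow_succ' 2 n, mul_smul]
  exact theta_zero_sq_two_smul (two_pow_smul_mem_siegelH2 h n) b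

theorem pairwiseAcute_theta_two_pow_smul_spAct_gamma (k : Fin 4) (n : ℕ) {τ}
    (h : τ ∈ minkowskiDomain) :
    PairwiseAcute fun b => theta 0 b ((2 : ℂ) ^ n • spAct (gamma k) τ) := by
  induction n generalizing τ with
  | zero => simpa only [pow_zero, one_smul] using pairwiseAcute_theta_spAct_gamma h k
  | succ n ih =>
    have hcont (b : Fin 2 → ZMod 2) :=
      (continuousOn_theta_two_pow_smul_spAct_gamma 0 b k (n + 1)).mono
        minkowskiDomain_subset_siegelH2
    refine PairwiseAcute.of_isPreconnected convex_minkowskiDomain.isPreconnected hcont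
      (fun σ hσ => ?_) baseMatrix_mem_minkowskiDomain (pairwiseAcute_theta_of_isMinkowskiReduced
        (isMinkowskiReduced_two_pow_smul_spAct_gamma_baseMatrix k n)) h
    refine re_mul_conj_ne_zero_of_inGoodPosition (ih hσ).inGoodPosition (r := 1 / 4) (by norm_num)
      fun b => ?_
    rw [theta_zero_sq_two_pow_succ_smul (spAct_gamma_mem_siegelH2
      (minkowskiDomain_subset_siegelH2 hσ) k)]
    norm_num

lemma FTwo_subset_FPrime : FTwo ⊆ FPrime := by
  rintro τ ⟨hτ, hx₁, hx₂, hx₃, hy₀, hy₃, hy₂, hdet⟩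
  have hn₁ : 1 ≤ ‖τ 0 0‖ := by
    simpa [gamma, blockC_gammaOf, blockD_gammaOf, Matrix.det_fin_two, pow_two,
      Matrix.mul_apply] using hdet (gamma 1)
  have hn₂ : 1 ≤ ‖τ 1 1‖ := by
    simpa [gamma, blockC_gammaOf, blockD_gammaOf, Matrix.det_fin_two, pow_two,
      Matrix.mul_apply] using hdet (gamma 2)
  have hy₁ : √3 / 2 ≤ (τ 0 0).im := by
    rw [Complex.norm_eq_sqrt_sq_add_sq, Real.one_le_sqrt] at hn₁
    rw [div_le_iff₀ two_pos, Real.sqrt_le_left (by linarith)]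
    nlinarith [sq_le_sq' (abs_le.1 hx₁).1 (abs_le.1 hx₁).2]
  rw [← abs_of_nonneg (nonneg_of_mul_nonneg_right hy₀ two_pos)] at hy₃
  exact ⟨hτ, hx₁, hx₂, hx₃, hy₃, hy₂, hy₁, hn₁, hn₂⟩

lemma thetaNum_mem_range {j : ℕ} (hj : j ∈ Set.Icc 0 3) (τ : Matrix (Fin 2) (Fin 2) ℂ) :
    thetaNum j τ ∈ Set.range fun b => theta 0 b τ := by
  have h₄ : j / 4 = 0 := Nat.div_eq_of_lt (by have := hj.2; lia)
  have h₈ : j / 8 = 0 := Nat.div_eq_of_lt (by have := hj.2; lia)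
  have hzero : (![0, 0] : Fin 2 → ZMod 2) = 0 := by decide
  rw [thetaNum, h₄, h₈, Nat.cast_zero, hzero]
  exact Set.mem_range_self _

end GoodSigns

end SiegelTheta

open SiegelTheta

theorem theorem1_general {τ : Matrix (Fin 2) (Fin 2) ℂ} (hτ : τ ∈ minkowskiDomain) (k : Fin 4) :
    (∀ n : ℕ, InGoodPosition
      ((fun j : ℕ => thetaNum j ((2 : ℂ) ^ n • spAct (gamma k) τ)) '' Set.Icc 0 3)) ∧
    IsGoodBorchardt (borchardtSeq (spAct (gamma k) τ)) := by
  have hgood (n : ℕ) := (pairwiseAcute_theta_two_pow_smul_spAct_gamma k n hτ).inGoodPosition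
  have hmem := spAct_gamma_mem_siegelH2 (minkowskiDomain_subset_siegelH2 hτ) k
  refine ⟨fun n => ?_, fun n b => theta 0 b ((2 : ℂ) ^ n • spAct (gamma k) τ),
    fun n => ⟨fun b => rfl, theta_zero_sq_two_pow_succ_smul hmem n⟩, hgood⟩
  obtain ⟨u, hu, hquarter⟩ := hgood n
  refine ⟨u, hu, ?_⟩
  rintro _ ⟨j, hj, rfl⟩
  exact hquarter _ (thetaNum_mem_range hj _)

theorem theorem1 :
    FTwo ⊆ FPrime ∧
    ∀ τ ∈ FPrime, ∀ k : Fin 4,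
      (∀ n : ℕ, InGoodPosition
        ((fun j : ℕ => thetaNum j ((2 : ℂ) ^ n • spAct (gamma k) τ)) '' Set.Icc 0 3)) ∧
      IsGoodBorchardt (borchardtSeq (spAct (gamma k) τ)) :=
  ⟨FTwo_subset_FPrime, fun _ hτ k => theorem1_general (FPrime_subset_minkowskiDomain hτ) k⟩
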